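/- Let $\mathfrak X=(X,\rho,\mu)$ be a metric space with a Borel measure such that $X$ is bounded, $\mu(X)<\infty$ and every open ball $B(x,s)$, $s>0$, has positive measure. For Borel $f:X\to\mathbb C$ let $$\mathcal M_{\mathfrak X}f(x)=\sup_{s>0}\frac1{\mu(B(x,s))}\int_{B(x,s)}|f|\,d\mu ,\qquad d_f(t)=\mu(\{x\in X:|f(x)|>t\}),$$ and, for $p\in[1,\infty)$, let $\|f\|_{p,q}=p^{1/q}\bigl(\int_0^\infty (t\,d_f(t)^{1/p})^q\,\frac{dt}t\bigr)^{1/q}$ if $q\in[1,\infty)$ and $\|f\|_{p,\infty}=\sup_{t>0}t\,d_f(t)^{1/p}$ (likewise for functions with values in $[0,\infty]$). Let $L^{p,q}(\mathfrak X)$ be the set of Borel $f:X\to\mathbb C$ with $\|f\|_{p,q}<\infty$. Let $\mathbf c(p,q,r,\mathfrak X)$ be the smallest $c\in[0,\infty)$ such that $\|\mathcal M_{\mathfrak X}f\|_{p,r}\le c\,\|f\|_{p,q}$ for all $f\in L^{p,q}(\mathfrak X)$, and $\infty$ if there is no such $c$. The space $\mathfrak X$ is non-doubling if there is no $C<\infty$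 with $\mu(B(x,2s))\le C\mu(B(x,s))$ for all $x\in X$, $s>0$. Theorem 1. Let $(p_0,q_0,r_0)$ satisfy either $p_0=q_0=1$ and $r_0\in[1,\infty]$, or $p_0\in(1,\infty)$ and $1\le q_0\le r_0\le\infty$. Then (here $[v,v)=(v,v]=\emptyset$ for $v\in[1,\infty]$): - there is a non-doubling space $\mathfrak U$ of the above kind such that $\mathbf c(p_0,q_0,r,\mathfrak U)=\infty$ for all $r\in[q_0,r_0]$ and $\mathbf c(p_0,q_0,r,\mathfrak U)<\infty$ for all $r\in(r_0,\infty]$; - there is a non-doubling space $\mathfrak V$ of the above kind such that $\mathbf c(p_0,q_0,r,\mathfrak V)=\infty$ for all $r\in[q_0,r_0)$ and $\mathbf c(p_0,q_0,r,\mathfrak V)<\infty$ for all $r\in[r_0,\infty]$. -/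

import Mathlib

open MeasureTheory Set
open scoped ENNReal NNReal

noncomputable section

namespace LorentzMaximal

/-- The standing assumptions on a metric measure space: `(X, ρ)` is bounded, `μ(X) < ∞`, and every
open ball of positive radius has strictly positive measure. -/
structure IsFiniteBoundedSpace {X : Type*} [MetricSpace X] [MeasurableSpace X]
    (μ : Measure X) : Prop where
  bounded : Bornology.IsBounded (univ : Set X)
  finite : μ univ < ∞
  ball_pos : ∀ (x : X) (s : ℝ), 0 < s → 0 < μ (Metric.ball x s)

/-- The (global) doubling condition: `μ(B(x, 2s)) ≤ C μ(B(x, s))` for all `x` and all `s > 0`. -/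
def IsDoubling {X : Type*} [MetricSpace X] [MeasurableSpace X] (μ : Measure X) : Prop :=
  ∃ C : ℝ≥0, ∀ (x : X) (s : ℝ), 0 < s →
    μ (Metric.ball x (2 * s)) ≤ C * μ (Metric.ball x s)

/-- The centered Hardy–Littlewood maximal operator. -/
def maximal {X : Type*} [MetricSpace X] [MeasurableSpace X] (μ : Measure X)
    (f : X → ℂ) (x : X) : ℝ≥0∞ :=
  ⨆ (s : ℝ) (_ : 0 < s), (μ (Metric.ball x s))⁻¹ * ∫⁻ y in Metric.ball x s, ‖f y‖ₑ ∂μ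

/-- The distribution function `t ↦ μ {x | g x > t}` of a function with values in `[0, ∞]`
(`g = |f|`, or `g` a maximal function). -/
def distribution {X : Type*} [MeasurableSpace X] (μ : Measure X) (g : X → ℝ≥0∞) (t : ℝ) : ℝ≥0∞ :=
  μ {x | ENNReal.ofReal t < g x}

/-- The Lorentz quasi-norm with exponents `p` and `q` of a function with values in `[0, ∞]`:
`p^{1/q} (∫_0^∞ (t d(t)^{1/p})^q dt/t)^{1/q}` for `q < ∞`, and `sup_{t>0} t d(t)^{1/p}` for
`q = ∞`. -/
def lorentzNorm {X : Type*} [MeasurableSpace X] (μ : Measure X) (p : ℝ) (q : ℝ≥0∞)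
    (g : X → ℝ≥0∞) : ℝ≥0∞ :=
  if q = ∞ then
    ⨆ (t : ℝ) (_ : 0 < t), ENNReal.ofReal t * distribution μ g t ^ (1 / p)
  else
    ENNReal.ofReal p ^ (1 / q.toReal) *
      (∫⁻ t in Ioi (0 : ℝ),
        (ENNReal.ofReal t * distribution μ g t ^ (1 / p)) ^ q.toReal / ENNReal.ofReal t) ^
          (1 / q.toReal)

/-- The smallest constant `c ∈ [0, ∞)` such that `‖𝓜 f‖_{p,r} ≤ c ‖f‖_{p,q}` for all Borel
functions `f` in the Lorentz space with exponents `p` and `q`; it is `∞` if there is no such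
constant. -/
def bestConst {X : Type*} [MetricSpace X] [MeasurableSpace X] (μ : Measure X)
    (p : ℝ) (q r : ℝ≥0∞) : ℝ≥0∞ :=
  ⨅ (c : ℝ≥0) (_ : ∀ f : X → ℂ, Measurable f → lorentzNorm μ p q (fun x => ‖f x‖ₑ) < ∞ →
    lorentzNorm μ p r (maximal μ f) ≤ c * lorentzNorm μ p q (fun x => ‖f x‖ₑ)), (c : ℝ≥0∞)

/-- Admissible triples of exponents. -/
def Admissible (p : ℝ) (q r : ℝ≥0∞) : Prop :=
  (p = 1 ∧ q = 1 ∧ 1 ≤ r) ∨ (1 < p ∧ 1 ≤ q ∧ q ≤ r)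

end LorentzMaximal

end

/-! The space is a union of stars. Star `n` has a hub and `n + 1` branches; branch `a` has `N a`
leaves, each a near point joined to the hub and a far point joined to the near point. Positive
distances are 1 or 2, so a ball is a singleton, a point with its neighbours, or everything, and the
maximal function is at most a finite sum of averages (`maximal_le`). All these pieces but one are
bounded from L^{p,q} to L^{p,r} for every r ≥ q. The exception is the hub as seen from the near
points of its star.

The hub has mass 2^(-p e n), and the near points of branch `a` have total mass 2^(-p j a). The
indicator of the hub has norm about 2^(-e n), while its maximal function has height about 2^(-p e n)
/ w a on the near points of `a`. The exponents in each family are distinct, and for such lacunary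
masses the L^{p,r} norm of a function with heights h i on sets of mass 2^(-p e i) is comparable to
the ℓ^r norm of h i 2^(-e i) (`exists_lorentzFun_lacDist_le`, `exists_seqNorm_le_lorentzFun`). The
parameters are tuned so that each of the `n + 1` branches contributes exactly β n 2^(-e n) to this
ℓ^r norm. The hub is thus amplified by about β n (n + 1)^(1/r), and the maximal operator is bounded
exactly when this quantity is bounded in n (`bdd_maximal`, `exists_le_of_bdd_maximal`).

Taking β n = (n + 1)^(-1/r₀) gives boundedness exactly for r ≥ r₀; an additional logarithmic factor
gives it exactly for r > r₀. -/

noncomputable section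

namespace LorentzMaximal

/-! ### Lorentz quasi-norms as functionals of the distribution function -/

/-- The Lorentz quasi-norm as a functional of the distribution function. -/
def lorentzFun (p : ℝ) (q : ℝ≥0∞) (d : ℝ → ℝ≥0∞) : ℝ≥0∞ :=
  if q = ∞ then
    ⨆ (t : ℝ) (_ : 0 < t), ENNReal.ofReal t * d t ^ (1 / p)
  else
    ENNReal.ofReal p ^ (1 / q.toReal) *
      (∫⁻ t in Ioi (0 : ℝ),
        (ENNReal.ofReal t * d t ^ (1 / p)) ^ q.toReal / ENNReal.ofReal t) ^ (1 / q.toReal)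

theorem lorentzNorm_eq_lorentzFun {X : Type*} [MeasurableSpace X] (μ : Measure X) (p : ℝ)
    (q : ℝ≥0∞) (g : X → ℝ≥0∞) : lorentzNorm μ p q g = lorentzFun p q (distribution μ g) := rfl

/-- The norm of `ℓ^r` on `[0, ∞]`-valued families. -/
def seqNorm {ι : Type*} (r : ℝ≥0∞) (a : ι → ℝ≥0∞) : ℝ≥0∞ :=
  if r = ∞ then ⨆ i, a i else (∑' i, a i ^ r.toReal) ^ (1 / r.toReal)

theorem seqNorm_const_mul {ι : Type*} {r : ℝ≥0∞} (hr : 1 ≤ r) (c : ℝ≥0∞) (a : ι → ℝ≥0∞) :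
    seqNorm r (fun i => c * a i) = c * seqNorm r a := by
  unfold seqNorm
  split_ifs with h
  · rw [ENNReal.mul_iSup]
  · have hρ : 0 < r.toReal := ENNReal.toReal_pos (by positivity) h
    simp_rw [ENNReal.mul_rpow_of_nonneg _ _ hρ.le]
    rw [ENNReal.tsum_mul_left, ENNReal.mul_rpow_of_nonneg _ _ (by positivity),
      ← ENNReal.rpow_mul, mul_one_div_cancel hρ.ne', ENNReal.rpow_one]

theorem seqNorm_mono {ι : Type*} {r : ℝ≥0∞} {a b : ι → ℝ≥0∞} (h : ∀ i, a i ≤ b i) :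
    seqNorm r a ≤ seqNorm r b := by
  unfold seqNorm
  split_ifs
  · exact iSup_mono h
  · gcongr with i
    exact h i

theorem seqNorm_fin_const {r : ℝ≥0∞} (hr : 1 ≤ r) (n : ℕ) (c : ℝ≥0∞) :
    seqNorm r (fun _ : Fin (n + 1) => c) = ((n : ℝ≥0∞) + 1) ^ (1 / r.toReal) * c := by
  unfold seqNorm
  split_ifs with h
  -- For r = ∞ the exponent `1 / r.toReal` is 1 / 0 = 0, so the factor is 1, as it should be for a
  -- supremum.
  · simp [h]
  · have hρ : 0 < r.toReal := ENNReal.toReal_pos (by positivity) h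
    simp only [tsum_fintype, Finset.sum_const, Finset.card_univ, Fintype.card_fin, nsmul_eq_mul]
    rw [ENNReal.mul_rpow_of_nonneg _ _ (by positivity), ← ENNReal.rpow_mul,
      mul_one_div_cancel hρ.ne', ENNReal.rpow_one]
    push_cast
    rfl

/-- The integrand of the Lorentz quasi-norm, with the powers of `t` collected. -/
theorem integrand_eq {p ρ : ℝ} (hρ : 0 ≤ ρ) (t : ℝ) (D : ℝ≥0∞) :
    (ENNReal.ofReal t * D ^ (1 / p)) ^ ρ / ENNReal.ofReal t =
      (ENNReal.ofReal t ^ ρ / ENNReal.ofReal t) * D ^ (ρ / p) := by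
  rw [ENNReal.mul_rpow_of_nonneg _ _ hρ, ← ENNReal.rpow_mul, one_div_mul_eq_div,
    ENNReal.mul_div_right_comm]

theorem lorentzFun_le_const_mul {p : ℝ} (hp : 1 ≤ p) {q : ℝ≥0∞} (hq : 1 ≤ q) {K : ℝ≥0∞}
    (hK : K ≠ ∞) {d d' : ℝ → ℝ≥0∞} (h : ∀ t, 0 < t → d t ≤ K * d' t) :
    lorentzFun p q d ≤ K ^ (1 / p) * lorentzFun p q d' := by
  have hp0 : 0 < p := by linarith
  have hK' : K ^ (1 / p) ≠ ∞ := ENNReal.rpow_ne_top_of_nonneg (by positivity) hK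
  have key : ∀ t, 0 < t → ENNReal.ofReal t * d t ^ (1 / p) ≤
      K ^ (1 / p) * (ENNReal.ofReal t * d' t ^ (1 / p)) := fun t ht => by
    rw [mul_left_comm, ← ENNReal.mul_rpow_of_nonneg _ _ (by positivity)]
    gcongr
    exact h t ht
  unfold lorentzFun
  split_ifs with hqi
  · rw [ENNReal.mul_iSup]
    refine iSup_mono fun t => ?_
    rw [ENNReal.mul_iSup]
    exact iSup_mono fun ht => key t ht
  · have hρ : 0 < q.toReal := ENNReal.toReal_pos (by positivity) hqi
    rw [mul_left_comm]
    gcongr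
    calc (∫⁻ t in Ioi (0 : ℝ), (ENNReal.ofReal t * d t ^ (1 / p)) ^ q.toReal /
          ENNReal.ofReal t) ^ (1 / q.toReal)
        ≤ (∫⁻ t in Ioi (0 : ℝ), (K ^ (1 / p)) ^ q.toReal *
          ((ENNReal.ofReal t * d' t ^ (1 / p)) ^ q.toReal /
          ENNReal.ofReal t)) ^ (1 / q.toReal) := by
          gcongr ?_ ^ _
          refine setLIntegral_mono' measurableSet_Ioi fun t ht => ?_
          rw [← mul_div_assoc, ← ENNReal.mul_rpow_of_nonneg _ _ hρ.le]
          exact ENNReal.div_le_div_right (ENNReal.rpow_le_rpow (key t ht) hρ.le) _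
      _ = _ := by
          rw [lintegral_const_mul' _ _ (ENNReal.rpow_ne_top_of_nonneg hρ.le hK'),
            ENNReal.mul_rpow_of_nonneg _ _ (by positivity), ← ENNReal.rpow_mul,
            mul_one_div_cancel hρ.ne', ENNReal.rpow_one]

theorem lorentzFun_mono {p : ℝ} (hp : 1 ≤ p) {q : ℝ≥0∞} (hq : 1 ≤ q)
    {d d' : ℝ → ℝ≥0∞} (h : ∀ t, 0 < t → d t ≤ d' t) :
    lorentzFun p q d ≤ lorentzFun p q d' := by
  simpa using lorentzFun_le_const_mul hp hq ENNReal.one_ne_top (d := d) (d' := d')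
    (by simpa using h)

theorem lintegral_Ioi_comp_half (F : ℝ → ℝ≥0∞) (hF : Measurable F) :
    ∫⁻ t in Ioi (0 : ℝ), F (t / 2) = 2 * ∫⁻ t in Ioi (0 : ℝ), F t := by
  have h2 : Measure.map (fun t : ℝ => 2⁻¹ * t) volume = (2 : ℝ≥0∞) • volume := by
    have := Real.map_volume_mul_left (a := (2⁻¹ : ℝ)) (by norm_num)
    simpa using this
  have hm : Measurable fun t : ℝ => 2⁻¹ * t := by fun_prop
  rw [← lintegral_indicator measurableSet_Ioi, ← lintegral_indicator measurableSet_Ioi]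
  have h3 : ∫⁻ t, (Ioi (0 : ℝ)).indicator F t ∂(Measure.map (fun t : ℝ => 2⁻¹ * t) volume) =
      2 * ∫⁻ t, (Ioi (0 : ℝ)).indicator F t := by
    rw [h2, lintegral_smul_measure, smul_eq_mul]
  rw [← h3, lintegral_map (hF.indicator measurableSet_Ioi) hm]
  refine lintegral_congr fun t => ?_
  by_cases ht : 0 < t
  · rw [indicator_of_mem (by exact ht), indicator_of_mem (by simpa using ht)]
    congr 1
    ring
  · rw [indicator_of_notMem (by exact ht), indicator_of_notMem (by simpa using ht)]

theorem lorentzFun_comp_half {p : ℝ} {q : ℝ≥0∞} (hq : 1 ≤ q)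
    {d : ℝ → ℝ≥0∞} (hd : Antitone d) :
    lorentzFun p q (fun t => d (t / 2)) = 2 * lorentzFun p q d := by
  have h2 : ∀ t : ℝ, ENNReal.ofReal t = 2 * ENNReal.ofReal (t / 2) := fun t => by
    rw [← ENNReal.ofReal_ofNat 2, ← ENNReal.ofReal_mul (by norm_num)]
    congr 1
    ring
  unfold lorentzFun
  split_ifs with hqi
  · rw [ENNReal.mul_iSup]
    refine (Equiv.divRight₀ (2 : ℝ) two_ne_zero).iSup_congr fun t => ?_
    rw [ENNReal.mul_iSup]
    simp only [Equiv.divRight₀_apply]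
    refine iSup_congr_Prop (by simp) fun ht => ?_
    rw [h2 t, mul_assoc]
  · have hρ : 0 < q.toReal := ENNReal.toReal_pos (by positivity) hqi
    rw [mul_left_comm]
    congr 1
    have h3 := lintegral_Ioi_comp_half (fun t => (2 : ℝ≥0∞) ^ q.toReal / 2 *
      ((ENNReal.ofReal t * d t ^ (1 / p)) ^ q.toReal / ENNReal.ofReal t)) (by
        have := hd.measurable
        fun_prop)
    have h4 : ∀ t : ℝ, (ENNReal.ofReal t * d (t / 2) ^ (1 / p)) ^ q.toReal / ENNReal.ofReal t =
        (2 : ℝ≥0∞) ^ q.toReal / 2 * ((ENNReal.ofReal (t / 2) * d (t / 2) ^ (1 / p)) ^ q.toReal /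
          ENNReal.ofReal (t / 2)) := fun t => by
      rw [h2 t, mul_assoc, ENNReal.mul_rpow_of_nonneg _ _ hρ.le]
      simp only [div_eq_mul_inv]
      rw [ENNReal.mul_inv (by simp) (by simp)]
      ring
    simp_rw [h4]
    rw [h3, lintegral_const_mul' _ _ (by
      exact ENNReal.div_ne_top (ENNReal.rpow_ne_top_of_nonneg hρ.le (by simp)) (by simp)),
      ← mul_assoc, ENNReal.mul_div_cancel (by simp) (by simp),
      ENNReal.mul_rpow_of_nonneg _ _ (by positivity), ← ENNReal.rpow_mul,
            mul_one_div_cancel hρ.ne', ENNReal.rpow_one]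

/-- The quasi-triangle inequality. -/
theorem lorentzFun_add_le {p : ℝ} (hp : 1 ≤ p) {q : ℝ≥0∞} (hq : 1 ≤ q)
    {d d₁ d₂ : ℝ → ℝ≥0∞} (h₁ : Antitone d₁) (h₂ : Antitone d₂)
    (h : ∀ t, 0 < t → d t ≤ d₁ (t / 2) + d₂ (t / 2)) :
    lorentzFun p q d ≤ 4 * (lorentzFun p q d₁ + lorentzFun p q d₂) := by
  have hp0 : 0 < p := by linarith
  have hm : lorentzFun p q d ≤ lorentzFun p q (fun t => (fun s => d₁ s + d₂ s) (t / 2)) :=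
    lorentzFun_mono hp hq h
  rw [lorentzFun_comp_half hq (h₁.add h₂)] at hm
  refine hm.trans ?_
  -- One factor 2 is the cost of the dilation t ↦ t / 2; the other covers the constant 2^((ρ-1)/ρ)
  -- from convexity of the ρ-th power.
  have h4 : (4 : ℝ≥0∞) = 2 * 2 := by norm_num
  rw [h4, mul_assoc]
  gcongr
  have key : ∀ t : ℝ, ENNReal.ofReal t * (d₁ t + d₂ t) ^ (1 / p) ≤
      ENNReal.ofReal t * d₁ t ^ (1 / p) + ENNReal.ofReal t * d₂ t ^ (1 / p) := fun t => by
    rw [← mul_add]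
    gcongr
    exact ENNReal.rpow_add_le_add_rpow _ _ (by positivity) (by rw [div_le_one hp0]; exact hp)
  unfold lorentzFun
  split_ifs with hqi
  · refine iSup₂_le fun t ht => (key t).trans ?_
    refine le_trans (add_le_add (le_iSup₂ (f := fun (t : ℝ) (_ : 0 < t) =>
      ENNReal.ofReal t * d₁ t ^ (1 / p)) t ht) (le_iSup₂ (f := fun (t : ℝ) (_ : 0 < t) =>
      ENNReal.ofReal t * d₂ t ^ (1 / p)) t ht)) ?_
    exact le_mul_of_one_le_left' (by norm_num)
  · have hρ1 : 1 ≤ q.toReal := by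
      rwa [← ENNReal.toReal_one, ENNReal.toReal_le_toReal (by simp) hqi]
    have hρ : 0 < q.toReal := by linarith
    rw [← mul_add, mul_left_comm]
    gcongr
    set ρ := q.toReal
    have hm1 := h₁.measurable
    have hm2 := h₂.measurable
    calc (∫⁻ t in Ioi (0 : ℝ), (ENNReal.ofReal t * (d₁ t + d₂ t) ^ (1 / p)) ^ ρ /
          ENNReal.ofReal t) ^ (1 / ρ)
        ≤ (∫⁻ t in Ioi (0 : ℝ), 2 ^ (ρ - 1) *
          ((ENNReal.ofReal t * d₁ t ^ (1 / p)) ^ ρ / ENNReal.ofReal t +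
          (ENNReal.ofReal t * d₂ t ^ (1 / p)) ^ ρ / ENNReal.ofReal t)) ^ (1 / ρ) := by
          gcongr with t
          rw [← ENNReal.add_div, ← mul_div_assoc]
          gcongr
          refine le_trans (ENNReal.rpow_le_rpow (key t) hρ.le) ?_
          exact ENNReal.rpow_add_le_mul_rpow_add_rpow _ _ hρ1
      _ = (2 ^ (ρ - 1)) ^ (1 / ρ) * ((∫⁻ t in Ioi (0 : ℝ),
          (ENNReal.ofReal t * d₁ t ^ (1 / p)) ^ ρ / ENNReal.ofReal t) +
          ∫⁻ t in Ioi (0 : ℝ),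
          (ENNReal.ofReal t * d₂ t ^ (1 / p)) ^ ρ / ENNReal.ofReal t) ^ (1 / ρ) := by
          rw [lintegral_const_mul' _ _ (ENNReal.rpow_ne_top_of_nonneg (by linarith) (by simp)),
            ENNReal.mul_rpow_of_nonneg _ _ (by positivity), lintegral_add_left (by fun_prop)]
      _ ≤ _ := by
          gcongr
          · rw [← ENNReal.rpow_mul]
            conv_rhs => rw [← ENNReal.rpow_one 2]
            refine ENNReal.rpow_le_rpow_of_exponent_le (by norm_num) ?_
            rw [mul_one_div, div_le_one hρ]
            linarith
          · exact ENNReal.rpow_add_le_add_rpow _ _ (by positivity)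
              (by rw [div_le_one hρ]; exact hρ1)

theorem lintegral_rpow_div_of_lt {ρ : ℝ} (hρ : 1 ≤ ρ) {h : ℝ≥0∞} (hh : h ≠ ∞) :
    ∫⁻ t in Ioi (0 : ℝ), (if ENNReal.ofReal t < h then
      ENNReal.ofReal t ^ ρ / ENNReal.ofReal t else 0) = h ^ ρ / ENNReal.ofReal ρ := by
  have hρ0 : 0 < ρ := by linarith
  lift h to ℝ≥0 using hh
  have e1 : ∀ t ∈ Ioi (0 : ℝ), (if ENNReal.ofReal t < (h : ℝ≥0∞) then
      ENNReal.ofReal t ^ ρ / ENNReal.ofReal t else 0) =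
      (Iio (h : ℝ)).indicator (fun t => ENNReal.ofReal (t ^ (ρ - 1))) t := by
    intro t ht
    have ht' : 0 < t := ht
    have : ENNReal.ofReal t < (h : ℝ≥0∞) ↔ t < h := by
      rw [ENNReal.ofReal_lt_coe_iff ht'.le]
    rw [indicator_apply]
    simp only [mem_Iio, this]
    split_ifs
    · rw [ENNReal.ofReal_rpow_of_pos ht', ← ENNReal.ofReal_div_of_pos ht',
        Real.rpow_sub_one ht'.ne']
    · rfl
  rw [setLIntegral_congr_fun measurableSet_Ioi e1, lintegral_indicator measurableSet_Iio,
    Measure.restrict_restrict measurableSet_Iio, inter_comm, Ioi_inter_Iio,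
    restrict_Ioo_eq_restrict_Ioc, ← ofReal_integral_eq_lintegral_ofReal]
  · have h0 : (0 : ℝ) ≤ h := h.2
    rw [← intervalIntegral.integral_of_le h0, integral_rpow (Or.inl (by linarith))]
    rw [Real.zero_rpow (by linarith), sub_add_cancel, sub_zero, ENNReal.ofReal_div_of_pos hρ0,
      ← ENNReal.ofReal_rpow_of_nonneg h0 hρ0.le, ENNReal.ofReal_coe_nnreal]
  · exact (intervalIntegrable_iff_integrableOn_Ioc_of_le h.2).1
      (intervalIntegral.intervalIntegrable_rpow' (by linarith))
  · exact (ae_restrict_iff' measurableSet_Ioc).2 (ae_of_all _ fun t ht =>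
      Real.rpow_nonneg ht.1.le _)

/-! ### Lacunary families and ℓ^r norms -/

theorem exists_min_index {ι : Type*} (e : ι → ℕ) (P : ι → Prop) (hP : ∃ i, P i) :
    ∃ i, P i ∧ ∀ k, P k → e i ≤ e k := by
  classical
  obtain ⟨i, hi, h⟩ := (inferInstance : WellFoundedLT ℕ).wf.has_min (e '' {i | P i})
    (by obtain ⟨i, hi⟩ := hP; exact ⟨e i, i, hi, rfl⟩)
  obtain ⟨i, hi', rfl⟩ := hi
  exact ⟨i, hi', fun k hk => not_lt.1 (h _ ⟨k, hk, rfl⟩)⟩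

/-- Since the exponents are distinct, the sum is part of the geometric tail starting at m. -/
theorem tsum_pow_le_of_min {ι : Type*} {e : ι → ℕ} (he : Function.Injective e) (P : ι → Prop)
    [DecidablePred P] (x : ℝ≥0∞) {m : ℕ} (hm : ∀ k, P k → m ≤ e k) :
    ∑' i, (if P i then x ^ e i else 0) ≤ (1 - x)⁻¹ * x ^ m := by
  let g : ℕ → ℝ≥0∞ := fun k => if m ≤ k then x ^ k else 0
  have h1 : ∑' i, (if P i then x ^ e i else 0) ≤ ∑' i, g (e i) := by
    refine ENNReal.tsum_le_tsum fun i => ?_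
    by_cases hi : P i
    · simp [g, hi, hm i hi]
    · simp [hi]
  have h2 : ∑' k, g k = ∑' k : ℕ, x ^ k * x ^ m := by
    rw [← Summable.sum_add_tsum_nat_add' (f := g) (k := m) ENNReal.summable, Finset.sum_eq_zero, zero_add]
    · exact tsum_congr fun k => by simp [g, pow_add]
    · intro k hk
      simp [g, Finset.mem_range.1 hk]
  refine h1.trans ((ENNReal.tsum_comp_le_tsum_of_injective he g).trans ?_)
  rw [h2, ENNReal.tsum_mul_right, ENNReal.tsum_geometric]

/-- Sums over lacunary families commute with powers, up to constants. -/
theorem tsum_pow_rpow_le {ι : Type*} {e : ι → ℕ} (he : Function.Injective e) (P : ι → Prop)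
    [DecidablePred P] (x : ℝ≥0∞) {a b : ℝ} (ha : 0 < a) (hb : 0 < b) :
    (∑' i, (if P i then (x ^ a) ^ e i else 0)) ^ (b / a) ≤
      ((1 - x ^ a)⁻¹) ^ (b / a) * ∑' i, (if P i then (x ^ b) ^ e i else 0) := by
  -- The left sum is comparable to its term of least exponent, and the (b / a)-th power of that term
  -- is a single term of the right sum.
  by_cases hP : ∃ i, P i
  · obtain ⟨i, hi, hmin⟩ := exists_min_index e P hP
    have h1 := tsum_pow_le_of_min he P (x ^ a) hmin
    calc _ ≤ ((1 - x ^ a)⁻¹ * (x ^ a) ^ e i) ^ (b / a) :=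
          ENNReal.rpow_le_rpow h1 (by positivity)
      _ = ((1 - x ^ a)⁻¹) ^ (b / a) * (x ^ b) ^ e i := by
          rw [ENNReal.mul_rpow_of_nonneg _ _ (by positivity)]
          congr 1
          rw [← ENNReal.rpow_natCast, ← ENNReal.rpow_mul, ← ENNReal.rpow_mul,
            ← ENNReal.rpow_natCast, ← ENNReal.rpow_mul]
          congr 1
          field_simp
      _ ≤ _ := by
          gcongr
          have := ENNReal.le_tsum (f := fun i => if P i then (x ^ b) ^ e i else 0) i
          simpa [hi] using this
  · push Not at hP
    simp [hP, ENNReal.zero_rpow_of_pos (div_pos hb ha)]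

/-- The weight `2⁻¹`, whose powers `(2⁻¹)^(p j)` are the masses in a lacunary family. -/
def half : ℝ≥0∞ := 2⁻¹

theorem half_ne_top : half ≠ ∞ := by simp [half]

theorem half_ne_zero : half ≠ 0 := by simp [half]

theorem half_rpow_lt_one {a : ℝ} (ha : 0 < a) : half ^ a < 1 :=
  ENNReal.rpow_lt_one (by simp [half]) ha

theorem geom_const_ne_top {a : ℝ} (ha : 0 < a) : (1 - half ^ a)⁻¹ ≠ ∞ :=
  ENNReal.inv_ne_top.2 (tsub_pos_of_lt (half_rpow_lt_one ha)).ne'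

/-- The distribution function of a function taking the value `h i` on a set of mass
`2^(-p e i)`. -/
def lacDist {ι : Type*} (p : ℝ) (e : ι → ℕ) (h : ι → ℝ≥0∞) (t : ℝ) : ℝ≥0∞ :=
  ∑' i, if ENNReal.ofReal t < h i then (half ^ p) ^ e i else 0

theorem measurable_lacTerm (p : ℝ) (j : ℕ) (h : ℝ≥0∞) (ρ : ℝ) :
    Measurable fun t : ℝ => (ENNReal.ofReal t ^ ρ / ENNReal.ofReal t) *
      (if ENNReal.ofReal t < h then (half ^ p) ^ j else 0) := by
  refine Measurable.mul (by fun_prop) (Measurable.ite ?_ measurable_const measurable_const)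
  exact measurableSet_lt (by fun_prop) measurable_const

theorem lintegral_lacDist {ι : Type*} [Countable ι] {ρ : ℝ} (hρ : 1 ≤ ρ) (e : ι → ℕ)
    {h : ι → ℝ≥0∞} (hh : ∀ i, h i ≠ ∞) :
    ∫⁻ t in Ioi (0 : ℝ), (ENNReal.ofReal t ^ ρ / ENNReal.ofReal t) * lacDist ρ e h t =
      (ENNReal.ofReal ρ)⁻¹ * ∑' i, (h i * half ^ e i) ^ ρ := by
  unfold lacDist
  simp_rw [← ENNReal.tsum_mul_left]
  rw [lintegral_tsum fun i => (measurable_lacTerm _ _ _ _).aemeasurable]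
  refine tsum_congr fun i => ?_
  have : ∀ t : ℝ, (ENNReal.ofReal t ^ ρ / ENNReal.ofReal t) *
      (if ENNReal.ofReal t < h i then (half ^ ρ) ^ e i else 0) = (half ^ ρ) ^ e i *
      (if ENNReal.ofReal t < h i then (ENNReal.ofReal t ^ ρ / ENNReal.ofReal t) else 0) := by
    intro t
    split_ifs
    · rw [mul_comm]
    · simp
  simp_rw [this]
  rw [lintegral_const_mul' _ _ (by
    exact ENNReal.pow_ne_top (half_rpow_lt_one (by linarith)).ne_top),
    lintegral_rpow_div_of_lt hρ (hh i), ENNReal.mul_rpow_of_nonneg _ _ (by linarith),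
    div_eq_mul_inv]
  have : (half ^ ρ) ^ e i = (half ^ e i) ^ ρ := by
    rw [← ENNReal.rpow_natCast, ← ENNReal.rpow_natCast, ← ENNReal.rpow_mul, ← ENNReal.rpow_mul,
      mul_comm]
  rw [this]
  ring

theorem half_pow_rpow_inv {p : ℝ} (hp : 0 < p) (j : ℕ) : ((half ^ p) ^ j) ^ (1 / p) = half ^ j := by
  rw [← ENNReal.rpow_natCast, ← ENNReal.rpow_natCast, ← ENNReal.rpow_mul, ← ENNReal.rpow_mul]
  congr 1
  field_simp

/-- Upper half of the lacunary comparison. At each level t the power r / p of the distribution is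
moved inside the sum by `tsum_pow_rpow_le`; the integral then splits into the integrals of t^(r-1)
over (0, h i). -/
theorem exists_lorentzFun_lacDist_le {p : ℝ} (hp : 1 ≤ p) {r : ℝ≥0∞} (hr : 1 ≤ r) :
    ∃ C : ℝ≥0, ∀ (ι : Type) (e : ι → ℕ) (h : ι → ℝ≥0∞), Function.Injective e →
      (∀ i, h i ≠ ∞) →
      lorentzFun p r (lacDist p e h) ≤ C * seqNorm r (fun i => h i * half ^ e i) := by
  have hp0 : 0 < p := by linarith
  by_cases hri : r = ∞
  · refine ⟨(((1 - half ^ p)⁻¹) ^ (1 / p)).toNNReal, fun ι e h he hh => ?_⟩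
    rw [ENNReal.coe_toNNReal (ENNReal.rpow_ne_top_of_nonneg (by positivity)
      (geom_const_ne_top hp0))]
    simp only [lorentzFun, seqNorm, hri, if_true]
    refine iSup₂_le fun t ht => ?_
    by_cases hP : ∃ i, ENNReal.ofReal t < h i
    · obtain ⟨i, hi, hmin⟩ := exists_min_index e _ hP
      have h1 := tsum_pow_le_of_min he _ (half ^ p) hmin
      calc ENNReal.ofReal t * lacDist p e h t ^ (1 / p)
          ≤ h i * ((1 - half ^ p)⁻¹ * (half ^ p) ^ e i) ^ (1 / p) := by
            gcongr
            exact h1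
        _ = ((1 - half ^ p)⁻¹) ^ (1 / p) * (h i * half ^ e i) := by
            rw [ENNReal.mul_rpow_of_nonneg _ _ (by positivity), half_pow_rpow_inv hp0]
            ring
        _ ≤ _ := by
            gcongr
            exact le_iSup (fun i => h i * half ^ e i) i
    · push Not at hP
      have : lacDist p e h t = 0 := by
        simp [lacDist, fun i => not_lt.2 (hP i)]
      rw [this, ENNReal.zero_rpow_of_pos (by positivity)]
      simp
  · have hρ1 : 1 ≤ r.toReal := by
      rwa [← ENNReal.toReal_one, ENNReal.toReal_le_toReal (by simp) hri]
    set ρ := r.toReal with hρdef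
    have hρ : 0 < ρ := by linarith
    set C := ((1 - half ^ p)⁻¹) ^ (ρ / p) with hC
    have hCt : C ≠ ∞ := ENNReal.rpow_ne_top_of_nonneg (by positivity) (geom_const_ne_top hp0)
    set K := ENNReal.ofReal p ^ (1 / ρ) * (C * (ENNReal.ofReal ρ)⁻¹) ^ (1 / ρ) with hK
    have hKt : K ≠ ∞ := by
      refine ENNReal.mul_ne_top (ENNReal.rpow_ne_top_of_nonneg (by positivity) (by simp))
        (ENNReal.rpow_ne_top_of_nonneg (by positivity) (ENNReal.mul_ne_top hCt ?_))
      simpa using hρ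
    refine ⟨K.toNNReal, fun ι e h he hh => ?_⟩
    have : Countable ι := he.countable
    rw [ENNReal.coe_toNNReal hKt]
    simp only [lorentzFun, seqNorm, hri, if_false]
    rw [← hρdef, hK, mul_assoc]
    refine mul_le_mul_right ?_ _
    rw [← ENNReal.mul_rpow_of_nonneg _ _ (by positivity : 0 ≤ 1 / ρ)]
    refine ENNReal.rpow_le_rpow ?_ (by positivity)
    calc _ ≤ ∫⁻ t in Ioi (0 : ℝ), C *
          ((ENNReal.ofReal t ^ ρ / ENNReal.ofReal t) * lacDist ρ e h t) := by
          refine setLIntegral_mono' measurableSet_Ioi fun t ht => ?_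
          rw [integrand_eq hρ.le, mul_left_comm]
          gcongr
          exact tsum_pow_rpow_le he _ half hp0 hρ
      _ = _ := by
          rw [lintegral_const_mul' _ _ hCt, lintegral_lacDist hρ1 e hh, mul_assoc]

/-- Lower half of the comparison. Only a lower bound on `d` is assumed, so it applies to a maximal
function whose distribution is not computed exactly. -/
theorem exists_seqNorm_le_lorentzFun {p : ℝ} (hp : 1 ≤ p) {r : ℝ≥0∞} (hr : 1 ≤ r) :
    ∃ C : ℝ≥0, ∀ (ι : Type) (e : ι → ℕ) (h : ι → ℝ≥0∞) (d : ℝ → ℝ≥0∞), Function.Injective e →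
      (∀ i, h i ≠ ∞) → (∀ t, 0 < t → lacDist p e h t ≤ d t) →
      seqNorm r (fun i => h i * half ^ e i) ≤ C * lorentzFun p r d := by
  have hp0 : 0 < p := by linarith
  by_cases hri : r = ∞
  · refine ⟨1, fun ι e h d he hh hd => ?_⟩
    simp only [lorentzFun, seqNorm, hri, if_true, ENNReal.coe_one, one_mul]
    -- The distribution function uses a strict inequality, so the level tested must stay strictly
    -- below `h i`.
    refine iSup_le fun i => le_of_forall_lt_imp_le_of_dense ?_
    intro a ha
    by_cases ha0 : a = 0
    · simp [ha0]
    have hfin : half ^ e i ≠ ∞ := ENNReal.pow_ne_top half_ne_top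
    have hne : half ^ e i ≠ 0 := pow_ne_zero _ half_ne_zero
    have hlt : a / half ^ e i < h i := by
      rwa [ENNReal.div_lt_iff (Or.inl hne) (Or.inl hfin)]
    set s := a / half ^ e i with hs
    have hst : s ≠ ∞ := hlt.ne_top
    have hs0 : 0 < s := ENNReal.div_pos ha0 hfin
    refine le_trans ?_ (le_iSup₂ (f := fun (t : ℝ) (_ : 0 < t) =>
      ENNReal.ofReal t * d t ^ (1 / p)) s.toReal (ENNReal.toReal_pos hs0.ne' hst))
    rw [ENNReal.ofReal_toReal hst]
    calc a = s * half ^ e i := (ENNReal.div_mul_cancel hne hfin).symm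
      _ = s * ((half ^ p) ^ e i) ^ (1 / p) := by rw [half_pow_rpow_inv hp0]
      _ ≤ s * (lacDist p e h s.toReal) ^ (1 / p) := by
          gcongr
          have := ENNReal.le_tsum (f := fun i => if ENNReal.ofReal s.toReal < h i then
            (half ^ p) ^ e i else 0) i
          simpa [lacDist, ENNReal.ofReal_toReal hst, hlt] using this
      _ ≤ _ := by
          gcongr
          exact hd _ (ENNReal.toReal_pos hs0.ne' hst)
  · have hρ1 : 1 ≤ r.toReal := by
      rwa [← ENNReal.toReal_one, ENNReal.toReal_le_toReal (by simp) hri]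
    set ρ := r.toReal with hρdef
    have hρ : 0 < ρ := by linarith
    set C := (1 - half ^ ρ)⁻¹ with hC
    have hCt : C ≠ ∞ := geom_const_ne_top hρ
    set K := (ENNReal.ofReal ρ * C / ENNReal.ofReal p) ^ (1 / ρ) with hK
    have hp' : ENNReal.ofReal p ≠ 0 := by simpa using hp0
    have hKt : K ≠ ∞ := by
      refine ENNReal.rpow_ne_top_of_nonneg (by positivity)
        (ENNReal.div_ne_top (ENNReal.mul_ne_top (by simp) hCt) hp')
    refine ⟨K.toNNReal, fun ι e h d he hh hd => ?_⟩
    have : Countable ι := he.countable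
    rw [ENNReal.coe_toNNReal hKt]
    simp only [lorentzFun, seqNorm, hri, if_false]
    rw [← hρdef, hK, ← ENNReal.mul_rpow_of_nonneg _ _ (by positivity : 0 ≤ 1 / ρ),
      ← ENNReal.mul_rpow_of_nonneg _ _ (by positivity : 0 ≤ 1 / ρ)]
    gcongr ?_ ^ _
    rw [← mul_assoc, ENNReal.div_mul_cancel hp' (by simp), mul_assoc]
    have key : (ENNReal.ofReal ρ)⁻¹ * ∑' i, (h i * half ^ e i) ^ ρ ≤
        C * ∫⁻ t in Ioi (0 : ℝ), (ENNReal.ofReal t * d t ^ (1 / p)) ^ ρ / ENNReal.ofReal t := by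
      rw [← lintegral_lacDist hρ1 e hh, ← lintegral_const_mul' _ _ hCt]
      refine setLIntegral_mono' measurableSet_Ioi fun t ht => ?_
      rw [integrand_eq hρ.le, mul_left_comm]
      gcongr
      -- The power comparison is applied with the exponents in the reverse roles and then inverted
      -- by the power ρ / p.
      have h1 := tsum_pow_rpow_le he (fun i => ENNReal.ofReal t < h i) half hρ hp0
      have h2 := ENNReal.rpow_le_rpow (h1) (by positivity : 0 ≤ ρ / p)
      rw [← ENNReal.rpow_mul, ENNReal.mul_rpow_of_nonneg _ _ (by positivity : 0 ≤ ρ / p),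
        ← ENNReal.rpow_mul] at h2
      have h3 : p / ρ * (ρ / p) = 1 := by field_simp
      rw [h3, ENNReal.rpow_one, ENNReal.rpow_one] at h2
      refine h2.trans ?_
      gcongr
      exact hd t ht
    rw [← ENNReal.inv_mul_le_iff (by simpa using hρ) (by simp)]
    exact key

/-! ### Embeddings in the second exponent -/

/-- The weak quasi-norm is controlled by the other Lorentz quasi-norms. -/
theorem exists_lorentzFun_top_le {p : ℝ} (hp : 1 ≤ p) {q : ℝ≥0∞} (hq : 1 ≤ q) :
    ∃ C : ℝ≥0, ∀ d : ℝ → ℝ≥0∞, Antitone d → lorentzFun p ∞ d ≤ C * lorentzFun p q d := by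
  have hp0 : 0 < p := by linarith
  by_cases hqi : q = ∞
  · exact ⟨1, fun d _ => by simp [hqi]⟩
  have hρ1 : 1 ≤ q.toReal := by
    rwa [← ENNReal.toReal_one, ENNReal.toReal_le_toReal (by simp) hqi]
  set ρ := q.toReal with hρdef
  have hρ : 0 < ρ := by linarith
  have hp' : ENNReal.ofReal p ≠ 0 := by simpa using hp0
  set K := (ENNReal.ofReal ρ / ENNReal.ofReal p) ^ (1 / ρ) with hK
  have hKt : K ≠ ∞ := by
    refine ENNReal.rpow_ne_top_of_nonneg (by positivity)
      (ENNReal.div_ne_top (by simp) hp')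
  refine ⟨K.toNNReal, fun d hd => ?_⟩
  rw [ENNReal.coe_toNNReal hKt]
  simp only [lorentzFun, hqi, if_true, if_false]
  rw [← hρdef, hK, ← ENNReal.mul_rpow_of_nonneg _ _ (by positivity : 0 ≤ 1 / ρ),
    ← ENNReal.mul_rpow_of_nonneg _ _ (by positivity : 0 ≤ 1 / ρ)]
  rw [← mul_assoc, ENNReal.div_mul_cancel hp' (by simp)]
  refine iSup₂_le fun t ht => ?_
  rw [one_div ρ, ENNReal.le_rpow_inv_iff hρ]
  have hρ' : ENNReal.ofReal ρ ≠ 0 := by simpa using hρ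
  -- As `d` is antitone, the integrand at s < t is at least s^(ρ-1) d(t)^(ρ/p); this is the integral
  -- of the first factor.
  have h1 := lintegral_rpow_div_of_lt hρ1 (h := ENNReal.ofReal t) (by simp)
  by_cases hdt : d t = 0
  · simp [hdt, ENNReal.zero_rpow_of_pos (show 0 < p⁻¹ by positivity), ENNReal.zero_rpow_of_pos hρ]
  calc (ENNReal.ofReal t * d t ^ (1 / p)) ^ ρ
      = ENNReal.ofReal ρ * ((ENNReal.ofReal t ^ ρ / ENNReal.ofReal ρ) * d t ^ (ρ / p)) := by
        rw [← mul_assoc, ENNReal.mul_div_cancel hρ' (by simp),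
          ENNReal.mul_rpow_of_nonneg _ _ hρ.le, ← ENNReal.rpow_mul, one_div_mul_eq_div]
    _ ≤ _ := by
        gcongr
        rw [← h1, ← lintegral_mul_const'' _ (by
          refine (Measurable.ite (measurableSet_lt (by fun_prop) measurable_const) (by fun_prop)
            measurable_const).aemeasurable)]
        refine setLIntegral_mono' measurableSet_Ioi fun s hs => ?_
        rw [integrand_eq hρ.le]
        split_ifs with hst
        · gcongr
          exact hd (le_of_lt ((ENNReal.ofReal_lt_ofReal_iff ht).1 hst))
        · simp

/-- Lorentz quasi-norms decrease in the second exponent, up to constants. -/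
theorem exists_lorentzFun_le {p : ℝ} (hp : 1 ≤ p) {q r : ℝ≥0∞} (hq : 1 ≤ q) (hqr : q ≤ r) :
    ∃ C : ℝ≥0, ∀ d : ℝ → ℝ≥0∞, Antitone d → lorentzFun p q d < ∞ →
      lorentzFun p r d ≤ C * lorentzFun p q d := by
  obtain ⟨C, hC⟩ := exists_lorentzFun_top_le hp hq
  have hp0 : 0 < p := by linarith
  by_cases hri : r = ∞
  · exact ⟨C, fun d hd _ => hri ▸ hC d hd⟩
  have hqi : q ≠ ∞ := ne_top_of_le_ne_top hri hqr
  have hρ1 : 1 ≤ q.toReal := by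
    rwa [← ENNReal.toReal_one, ENNReal.toReal_le_toReal (by simp) hqi]
  have hσ1 : q.toReal ≤ r.toReal := by
    rwa [ENNReal.toReal_le_toReal hqi hri]
  set ρ := q.toReal with hρdef
  set σ := r.toReal with hσdef
  have hρ : 0 < ρ := by linarith
  have hσ : 0 < σ := by linarith
  have hp' : ENNReal.ofReal p ≠ 0 := by simpa using hp0
  set P : ℝ≥0∞ := ENNReal.ofReal p with hP
  set K : ℝ≥0∞ := P ^ (1 / σ) * ((C : ℝ≥0∞) ^ (σ - ρ) * P⁻¹) ^ (1 / σ) with hK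
  have hKt : K ≠ ∞ := by
    refine ENNReal.mul_ne_top (ENNReal.rpow_ne_top_of_nonneg (by positivity) (by simp [hP]))
      (ENNReal.rpow_ne_top_of_nonneg (by positivity) (ENNReal.mul_ne_top
        (ENNReal.rpow_ne_top_of_nonneg (by linarith) (by simp)) (by simpa [hP] using hp')))
  refine ⟨K.toNNReal, fun d hd hfin => ?_⟩
  rw [ENNReal.coe_toNNReal hKt]
  have hA := hC d hd
  set N := lorentzFun p q d with hN
  set A := lorentzFun p ∞ d with hAdef
  have hI : ∫⁻ t in Ioi (0 : ℝ), (ENNReal.ofReal t * d t ^ (1 / p)) ^ ρ / ENNReal.ofReal t =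
      P⁻¹ * N ^ ρ := by
    rw [hN, lorentzFun, if_neg hqi, ← hρdef, ENNReal.mul_rpow_of_nonneg _ _ hρ.le,
      ← ENNReal.rpow_mul, ← ENNReal.rpow_mul, one_div_mul_cancel hρ.ne', ENNReal.rpow_one,
      ENNReal.rpow_one, ← mul_assoc, ENNReal.inv_mul_cancel hp' (by simp [hP]), one_mul]
  have hNA : A ^ (σ - ρ) * N ^ ρ ≤ (C : ℝ≥0∞) ^ (σ - ρ) * N ^ σ := by
    calc A ^ (σ - ρ) * N ^ ρ ≤ (C * N) ^ (σ - ρ) * N ^ ρ := by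
          gcongr
      _ = _ := by
          rw [ENNReal.mul_rpow_of_nonneg _ _ (by linarith), mul_assoc,
            ← ENNReal.rpow_add_of_nonneg _ _ (by linarith) hρ.le, sub_add_cancel]
  have hAt : A ≠ ∞ := (hA.trans_lt (ENNReal.mul_lt_top (by simp) hfin)).ne
  rw [lorentzFun, if_neg hri, ← hσdef, hK, mul_assoc]
  gcongr
  -- The power σ is split as (σ - ρ) + ρ, and the first part is bounded by the weak norm `A`.
  calc (∫⁻ t in Ioi (0 : ℝ), (ENNReal.ofReal t * d t ^ (1 / p)) ^ σ /
        ENNReal.ofReal t) ^ (1 / σ)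
      ≤ (∫⁻ t in Ioi (0 : ℝ), A ^ (σ - ρ) * ((ENNReal.ofReal t * d t ^ (1 / p)) ^ ρ /
        ENNReal.ofReal t)) ^ (1 / σ) := by
        refine ENNReal.rpow_le_rpow ?_ (by positivity)
        refine setLIntegral_mono' measurableSet_Ioi fun t ht => ?_
        rw [← mul_div_assoc]
        refine ENNReal.div_le_div_right ?_ _
        have hle : ENNReal.ofReal t * d t ^ (1 / p) ≤ A := by
          rw [hAdef, lorentzFun, if_pos rfl]
          exact le_iSup₂ (f := fun (t : ℝ) (_ : 0 < t) =>
            ENNReal.ofReal t * d t ^ (1 / p)) t ht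
        calc (ENNReal.ofReal t * d t ^ (1 / p)) ^ σ
            = (ENNReal.ofReal t * d t ^ (1 / p)) ^ (σ - ρ) *
              (ENNReal.ofReal t * d t ^ (1 / p)) ^ ρ := by
              rw [← ENNReal.rpow_add_of_nonneg _ _ (by linarith) hρ.le, sub_add_cancel]
          _ ≤ _ := by
              gcongr
    _ ≤ (((C : ℝ≥0∞) ^ (σ - ρ) * P⁻¹) * N ^ σ) ^ (1 / σ) := by
        rw [lintegral_const_mul' _ _ (ENNReal.rpow_ne_top_of_nonneg (by linarith) hAt), hI]
        refine ENNReal.rpow_le_rpow ?_ (by positivity)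
        calc _ = P⁻¹ * (A ^ (σ - ρ) * N ^ ρ) := by ring
          _ ≤ P⁻¹ * ((C : ℝ≥0∞) ^ (σ - ρ) * N ^ σ) := by gcongr
          _ = _ := by ring
    _ = _ := by
        rw [ENNReal.mul_rpow_of_nonneg _ _ (by positivity), ← ENNReal.rpow_mul,
          mul_one_div_cancel hσ.ne', ENNReal.rpow_one]

/-! ### Hölder's inequality on sets -/

section Space

variable {X : Type*} [MeasurableSpace X] (μ : Measure X)

theorem distribution_antitone (g : X → ℝ≥0∞) : Antitone (distribution μ g) := fun _ _ hst =>
  measure_mono fun _ hx => (ENNReal.ofReal_le_ofReal hst).trans_lt hx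

theorem lintegral_eq_lintegral_distribution {g : X → ℝ≥0∞} (hg : Measurable g)
    (hfin : ∀ x, g x ≠ ∞) : ∫⁻ x, g x ∂μ = ∫⁻ t in Ioi (0 : ℝ), distribution μ g t := by
  have h := lintegral_eq_lintegral_meas_lt μ (f := fun x => (g x).toReal)
    (ae_of_all _ fun x => ENNReal.toReal_nonneg) hg.ennreal_toReal.aemeasurable
  simp only [ENNReal.ofReal_toReal (hfin _)] at h
  rw [h]
  refine setLIntegral_congr_fun measurableSet_Ioi fun t ht => ?_
  simp only [distribution, ENNReal.ofReal_lt_iff_lt_toReal (le_of_lt (mem_Ioi.1 ht)) (hfin _)]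

theorem lorentzFun_one_one (d : ℝ → ℝ≥0∞) : lorentzFun 1 1 d = ∫⁻ t in Ioi (0 : ℝ), d t := by
  simp only [lorentzFun, ENNReal.one_ne_top, if_false, ENNReal.toReal_one, div_one,
    ENNReal.rpow_one, ENNReal.ofReal_one, one_mul]
  refine setLIntegral_congr_fun measurableSet_Ioi fun t ht => ?_
  have ht' : 0 < t := ht
  rw [mul_comm]
  exact ENNReal.mul_div_cancel_right (by simpa using ht') (by simp)

theorem lintegral_Ioi_rpow_neg {p : ℝ} (hp : 1 < p) {s : ℝ} (hs : 0 < s) :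
    ∫⁻ t in Ioi s, ENNReal.ofReal t ^ (-p) = ENNReal.ofReal (s ^ (1 - p) / (p - 1)) := by
  have h1 : ∫⁻ t in Ioi s, ENNReal.ofReal t ^ (-p) = ∫⁻ t in Ioi s, ENNReal.ofReal (t ^ (-p)) :=
    setLIntegral_congr_fun measurableSet_Ioi fun t ht =>
      ENNReal.ofReal_rpow_of_pos (hs.trans ht)
  rw [h1, ← ofReal_integral_eq_lintegral_ofReal (integrableOn_Ioi_rpow_of_lt (by linarith) hs)
    ((ae_restrict_iff' measurableSet_Ioi).2 (ae_of_all _ fun t ht =>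
      Real.rpow_nonneg (hs.trans ht).le _)), integral_Ioi_rpow_of_lt (by linarith) hs]
  congr 1
  rw [show -p + 1 = -(p - 1) by ring, neg_div_neg_eq]
  congr 2
  ring

/-- Hölder's inequality for the indicator function of a set and a weak `L^p` function. -/
theorem setLIntegral_le_weak {p : ℝ} (hp : 1 < p) {f : X → ℂ} (hf : Measurable f) (E : Set X)
    (hE : μ E ≠ ∞) (hE0 : μ E ≠ 0) :
    ∫⁻ x in E, ‖f x‖ₑ ∂μ ≤ ENNReal.ofReal (1 + 1 / (p - 1)) *
      (μ E / μ E ^ (1 / p)) * lorentzNorm μ p ∞ (fun x => ‖f x‖ₑ) := by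
  have hp0 : 0 < p := by linarith
  rw [lintegral_eq_lintegral_distribution (μ.restrict E) hf.enorm fun _ => enorm_ne_top]
  set A := lorentzNorm μ p ∞ (fun x => ‖f x‖ₑ) with hA
  set m := μ E with hm
  have hmp : m ^ (1 / p) ≠ ∞ := ENNReal.rpow_ne_top_of_nonneg (by positivity) hE
  have hmp0 : m ^ (1 / p) ≠ 0 := by simp [hE0, hE]
  have hc0 : ENNReal.ofReal (1 + 1 / (p - 1)) * (m / m ^ (1 / p)) ≠ 0 := by
    have : 0 < 1 / (p - 1) := by
      have : 0 < p - 1 := by linarith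
      positivity
    refine mul_ne_zero ?_ (ENNReal.div_pos hE0 hmp).ne'
    rw [ne_eq, ENNReal.ofReal_eq_zero, not_le]
    linarith
  by_cases hAt : A = ∞
  · rw [hAt, ENNReal.mul_top hc0]
    exact le_top
  have hd : ∀ t : ℝ, 0 < t → distribution μ (fun x => ‖f x‖ₑ) t ≤
      A ^ p * ENNReal.ofReal t ^ (-p) := by
    intro t ht
    have h1 : ENNReal.ofReal t * distribution μ (fun x => ‖f x‖ₑ) t ^ (1 / p) ≤ A := by
      rw [hA, lorentzNorm, if_pos rfl]
      exact le_iSup₂ (f := fun (t : ℝ) (_ : 0 < t) => ENNReal.ofReal t *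
        distribution μ (fun x => ‖f x‖ₑ) t ^ (1 / p)) t ht
    have ht0 : ENNReal.ofReal t ≠ 0 := by simpa using ht
    have h2 := ENNReal.rpow_le_rpow h1 hp0.le
    rw [ENNReal.mul_rpow_of_nonneg _ _ hp0.le, ← ENNReal.rpow_mul,
      one_div_mul_cancel hp0.ne', ENNReal.rpow_one, mul_comm] at h2
    rw [ENNReal.rpow_neg, ← div_eq_mul_inv, ENNReal.le_div_iff_mul_le]
    · exact h2
    · left; simp [ht]
    · left; exact ENNReal.rpow_ne_top_of_nonneg hp0.le (by simp)
  have hdE : ∀ t, distribution (μ.restrict E) (fun x => ‖f x‖ₑ) t ≤ m := fun t => by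
    refine (measure_mono (subset_univ _)).trans ?_
    simp [hm]
  have hdle : ∀ t, distribution (μ.restrict E) (fun x => ‖f x‖ₑ) t ≤
      distribution μ (fun x => ‖f x‖ₑ) t := fun t =>
    Measure.restrict_apply_le _ _
  by_cases hA0 : A = 0
  · have : ∫⁻ t in Ioi (0 : ℝ), distribution (μ.restrict E) (fun x => ‖f x‖ₑ) t ≤
        ∫⁻ t in Ioi (0 : ℝ), 0 := setLIntegral_mono' measurableSet_Ioi fun t ht => by
      refine (hdle t).trans ((hd t ht).trans ?_)
      simp [hA0, ENNReal.zero_rpow_of_pos hp0]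
    refine this.trans (by simp)
  -- The layer-cake integral is cut at the level where the two bounds on the distribution, m and A^p
  -- t^(-p), coincide.
  set S := A / m ^ (1 / p) with hS
  have hSt : S ≠ ∞ := ENNReal.div_ne_top hAt hmp0
  have hS0 : S ≠ 0 := (ENNReal.div_pos hA0 hmp).ne'
  set s := S.toReal with hs
  have hs0 : 0 < s := ENNReal.toReal_pos hS0 hSt
  have hsS : ENNReal.ofReal s = S := ENNReal.ofReal_toReal hSt
  have hp1 : 0 < p - 1 := by linarith
  have hApm : A ^ p = S ^ p * m := by
    rw [hS, ENNReal.div_rpow_of_nonneg _ _ hp0.le, ← ENNReal.rpow_mul,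
      one_div_mul_cancel hp0.ne', ENNReal.rpow_one, ENNReal.div_mul_cancel hE0 hE]
  calc ∫⁻ t in Ioi (0 : ℝ), distribution (μ.restrict E) (fun x => ‖f x‖ₑ) t
      ≤ (∫⁻ t in Ioc 0 s, distribution (μ.restrict E) (fun x => ‖f x‖ₑ) t) +
        ∫⁻ t in Ioi s, distribution (μ.restrict E) (fun x => ‖f x‖ₑ) t :=
        by
        rw [← Ioc_union_Ioi_eq_Ioi hs0.le]
        exact lintegral_union_le _ _ _
    _ ≤ (∫⁻ t in Ioc 0 s, m) + ∫⁻ t in Ioi s, A ^ p * ENNReal.ofReal t ^ (-p) := by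
        refine add_le_add (lintegral_mono fun t => hdE t) ?_
        · refine setLIntegral_mono' measurableSet_Ioi fun t ht => ?_
          exact (hdle t).trans (hd t (lt_trans hs0 (mem_Ioi.1 ht)))
    _ = m * S + A ^ p * ENNReal.ofReal (s ^ (1 - p) / (p - 1)) := by
        rw [setLIntegral_const, Real.volume_Ioc, sub_zero, hsS,
          lintegral_const_mul' _ _ (ENNReal.rpow_ne_top_of_nonneg hp0.le hAt),
          lintegral_Ioi_rpow_neg hp hs0]
    _ = m * S + m * (S * ENNReal.ofReal (1 / (p - 1))) := by
        congr 1
        rw [hApm, mul_comm (S ^ p), mul_assoc, ← hsS, ENNReal.ofReal_rpow_of_pos hs0,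
          ← ENNReal.ofReal_mul (by positivity), ← ENNReal.ofReal_mul hs0.le]
        congr 2
        rw [← mul_div_assoc, ← Real.rpow_add hs0]
        simp [div_eq_mul_inv]
    _ = _ := by
        rw [ENNReal.ofReal_add zero_le_one (by positivity), hS, ENNReal.ofReal_one]
        simp only [div_eq_mul_inv]
        ring

/-- For p > 1 the weak norm suffices. For p = 1 that argument fails, since t^(-1) is not integrable
at infinity, and the identity L^{1,1} = L^1 replaces it. -/
theorem exists_setLIntegral_le {p : ℝ} {q : ℝ≥0∞} (h : (p = 1 ∧ q = 1) ∨ (1 < p ∧ 1 ≤ q)) :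
    ∃ C : ℝ≥0, ∀ f : X → ℂ, Measurable f → ∀ E : Set X, μ E ≠ ∞ → μ E ≠ 0 →
      (∫⁻ x in E, ‖f x‖ₑ ∂μ) / μ E ≤
        C * (lorentzNorm μ p q (fun x => ‖f x‖ₑ) / μ E ^ (1 / p)) := by
  rcases h with ⟨rfl, rfl⟩ | ⟨hp, hq⟩
  · refine ⟨1, fun f hf E hE hE0 => ?_⟩
    have := lintegral_eq_lintegral_distribution μ hf.enorm fun _ => enorm_ne_top
    rw [← lorentzFun_one_one, ← lorentzNorm_eq_lorentzFun] at this
    rw [← this]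
    simp only [div_one, ENNReal.rpow_one, ENNReal.coe_one, one_mul]
    exact ENNReal.div_le_div_right (setLIntegral_le_lintegral _ _) _
  · obtain ⟨C, hC⟩ := exists_lorentzFun_top_le hp.le hq
    refine ⟨(1 + 1 / (p - 1)).toNNReal * C, fun f hf E hE hE0 => ?_⟩
    have h1 := setLIntegral_le_weak μ hp hf E hE hE0
    have h2 := hC _ (distribution_antitone μ (fun x => ‖f x‖ₑ))
    rw [← lorentzNorm_eq_lorentzFun, ← lorentzNorm_eq_lorentzFun] at h2
    rw [ENNReal.div_le_iff hE0 hE]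
    refine h1.trans ((mul_le_mul_right h2 _).trans (le_of_eq ?_))
    rw [ENNReal.coe_mul, ← ENNReal.ofReal]
    simp only [div_eq_mul_inv]
    ring

end Space

/-! ### The star spaces: metric, balls, measure -/

/-- The index set of branches: branch `⟨n, i⟩` is the `i`-th branch of the `n`-th star. -/
abbrev Branch : Type := Σ n : ℕ, Fin (n + 1)

/-- The leaves: branch `a` carries `N a` of them. -/
abbrev Leaf (N : Branch → ℕ) : Type := Σ a : Branch, Fin (N a)

/-- The points of the space: hubs of stars, and for each leaf a near and a far point. -/
inductive Pt (N : Branch → ℕ) : Type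
  | hub (n : ℕ) : Pt N
  | near (l : Leaf N) : Pt N
  | far (l : Leaf N) : Pt N

namespace Pt

variable {N : Branch → ℕ}

/-- The adjacency relation: a hub is adjacent to the near points of its star, and a near
point is adjacent to the far point of the same leaf. -/
def Adj : Pt N → Pt N → Prop
  | hub n, near l => l.1.1 = n
  | near l, hub n => l.1.1 = n
  | near l, far k => l = k
  | far l, near k => k = l
  | _, _ => False

theorem Adj.symm {a b : Pt N} (h : Adj a b) : Adj b a := by
  cases a <;> cases b <;> exact h

theorem adj_comm (a b : Pt N) : Adj a b ↔ Adj b a := ⟨Adj.symm, Adj.symm⟩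

open scoped Classical in
/-- Distinct points are at distance `1` if they are adjacent, and at distance `2` otherwise. -/
instance : MetricSpace (Pt N) where
  dist a b := if a = b then 0 else if Adj a b then 1 else 2
  dist_self a := by simp
  dist_comm a b := by simp only [eq_comm (a := a), adj_comm a]
  dist_triangle a b c := by
    by_cases h1 : a = b
    · subst h1; simp
    by_cases h2 : b = c
    · subst h2; simp
    simp only [h1, h2, if_false]
    split_ifs <;> norm_num
  eq_of_dist_eq_zero {a b} h := by
    by_contra hab
    simp only [hab, if_false] at h
    split_ifs at h <;> norm_num at h

open scoped Classical in
theorem dist_eq (a b : Pt N) : dist a b = if a = b then 0 else if Adj a b then 1 else 2 := rfl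

theorem ball_of_le_one (a : Pt N) {s : ℝ} (hs : 0 < s) (h : s ≤ 1) : Metric.ball a s = {a} := by
  ext b
  rw [Metric.mem_ball, dist_eq, mem_singleton_iff]
  split_ifs with h1 h2
  · simp [h1, hs]
  · simp [h1, h]
  · simp only [h1, iff_false, not_lt]
    linarith

theorem ball_of_one_lt (a : Pt N) {s : ℝ} (hs : 1 < s) (h : s ≤ 2) :
    Metric.ball a s = {b | b = a ∨ Adj b a} := by
  ext b
  rw [Metric.mem_ball, dist_eq, mem_ofPred_eq]
  split_ifs with h1 h2
  · simp [h1]; linarith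
  · simp [h2, hs]
  · simp [h1, h2, h]

theorem ball_of_two_lt (a : Pt N) {s : ℝ} (hs : 2 < s) : Metric.ball a s = univ := by
  ext b
  rw [Metric.mem_ball, dist_eq]
  simp only [mem_univ, iff_true]
  split_ifs <;> linarith

instance : DiscreteTopology (Pt N) := by
  refine discreteTopology_iff_isOpen_singleton.2 fun a => ?_
  rw [← ball_of_le_one a one_pos le_rfl]
  exact Metric.isOpen_ball

instance : MeasurableSpace (Pt N) := ⊤

instance : BorelSpace (Pt N) := ⟨borel_eq_top_of_discrete.symm⟩

instance : DiscreteMeasurableSpace (Pt N) := ⟨fun _ => trivial⟩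

/-- The points around the `n`-th hub. -/
def ring (N : Branch → ℕ) (n : ℕ) : Set (Pt N) := {b | ∃ l : Leaf N, l.1.1 = n ∧ b = near l}

theorem ball_hub (n : ℕ) {s : ℝ} (hs : 1 < s) (h : s ≤ 2) :
    Metric.ball (hub n : Pt N) s = ring N n ∪ {hub n} := by
  rw [ball_of_one_lt _ hs h]
  ext b
  cases b with
  | near l =>
    simp only [mem_ofPred_eq, mem_union, mem_singleton_iff, reduceCtorEq, false_or, or_false,
      Adj, ring]
    refine ⟨fun h => ⟨l, h, rfl⟩, ?_⟩
    rintro ⟨k, hk, h⟩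
    cases h
    exact hk
  | _ => simp [ring, Adj]

theorem ball_near (l : Leaf N) {s : ℝ} (hs : 1 < s) (h : s ≤ 2) :
    Metric.ball (near l : Pt N) s = ({near l} ∪ {far l}) ∪ {hub l.1.1} := by
  rw [ball_of_one_lt _ hs h]
  ext b
  cases b <;> simp [Adj, eq_comm]

theorem ball_far (l : Leaf N) {s : ℝ} (hs : 1 < s) (h : s ≤ 2) :
    Metric.ball (far l : Pt N) s = {far l} ∪ {near l} := by
  rw [ball_of_one_lt _ hs h]
  ext b
  cases b <;> simp [Adj]

theorem isBounded_univ : Bornology.IsBounded (univ : Set (Pt N)) :=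
  Metric.isBounded_iff.2 ⟨2, fun a _ b _ => by
    rw [dist_eq]
    split_ifs <;> norm_num⟩

/-- The measure with the given masses of the hubs, the near points and the far points. -/
def measure (c : ℕ → ℝ≥0∞) (v w : Branch → ℝ≥0∞) : Measure (Pt N) :=
  Measure.sum (fun n => c n • Measure.dirac (hub n)) +
    Measure.sum (fun l : Leaf N => v l.1 • Measure.dirac (near l)) +
    Measure.sum (fun l : Leaf N => w l.1 • Measure.dirac (far l))

theorem lintegral_measure (c : ℕ → ℝ≥0∞) (v w : Branch → ℝ≥0∞) (g : Pt N → ℝ≥0∞) :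
    ∫⁻ a, g a ∂(measure c v w) = ∑' n, c n * g (hub n) +
      ∑' l : Leaf N, v l.1 * g (near l) + ∑' l : Leaf N, w l.1 * g (far l) := by
  simp [measure, lintegral_add_measure, lintegral_sum_measure]

open scoped Classical in
theorem measure_apply (c : ℕ → ℝ≥0∞) (v w : Branch → ℝ≥0∞) (E : Set (Pt N)) :
    measure c v w E = ∑' n, (if hub n ∈ E then c n else 0) +
      ∑' l : Leaf N, (if near l ∈ E then v l.1 else 0) +
      ∑' l : Leaf N, (if far l ∈ E then w l.1 else 0) := by
  rw [← lintegral_indicator_one (MeasurableSet.of_discrete), lintegral_measure]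
  simp [indicator_apply]

theorem distribution_measure (c : ℕ → ℝ≥0∞) (v w : Branch → ℝ≥0∞) (g : Pt N → ℝ≥0∞) (t : ℝ) :
    distribution (measure c v w) g t =
      ∑' n, (if ENNReal.ofReal t < g (hub n) then c n else 0) +
      ∑' l : Leaf N, (if ENNReal.ofReal t < g (near l) then v l.1 else 0) +
      ∑' l : Leaf N, (if ENNReal.ofReal t < g (far l) then w l.1 else 0) := by
  classical
  rw [distribution, measure_apply]
  simp only [mem_ofPred_eq]
  congr!

theorem tsum_leaf (φ : Branch → ℝ≥0∞) : ∑' l : Leaf N, φ l.1 = ∑' a, N a * φ a := by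
  rw [ENNReal.tsum_sigma' (f := fun l : Leaf N => φ l.1)]
  simp

@[simp]
theorem measure_hub (c : ℕ → ℝ≥0∞) (v w : Branch → ℝ≥0∞) (n : ℕ) :
    measure c v w {(hub n : Pt N)} = c n := by
  classical
  simp [measure_apply]

@[simp]
theorem measure_near (c : ℕ → ℝ≥0∞) (v w : Branch → ℝ≥0∞) (l : Leaf N) :
    measure c v w {(near l : Pt N)} = v l.1 := by
  classical
  rw [measure_apply, tsum_eq_single (β := Leaf N) l]
  · simp
  · intro k hk; simp [hk]

@[simp]
theorem measure_far (c : ℕ → ℝ≥0∞) (v w : Branch → ℝ≥0∞) (l : Leaf N) :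
    measure c v w {(far l : Pt N)} = w l.1 := by
  classical
  rw [measure_apply]
  simp only [mem_singleton_iff, reduceCtorEq, if_false, tsum_zero, zero_add]
  rw [tsum_eq_single (β := Leaf N) l]
  · simp
  · intro k hk; simp [hk]

end Pt

theorem ite_le_mul_ite {P Q : Prop} [Decidable P] [Decidable Q] {K a b : ℝ≥0∞} (h : P → Q)
    (hab : a ≤ K * b) : (if P then a else 0) ≤ K * (if Q then b else 0) := by
  by_cases hP : P
  · simpa [hP, h hP] using hab
  · simp [hP]

/-! ### Averages over unions -/

section Average

variable {X : Type*} [MeasurableSpace X] (μ : Measure X)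

/-- The average of `g` over `E`. -/
def avg (E : Set X) (g : X → ℝ≥0∞) : ℝ≥0∞ := (μ E)⁻¹ * ∫⁻ y in E, g y ∂μ

theorem avg_union_le (A B : Set X) (g : X → ℝ≥0∞) :
    avg μ (A ∪ B) g ≤ avg μ A g + avg μ B g := by
  unfold avg
  calc (μ (A ∪ B))⁻¹ * ∫⁻ y in A ∪ B, g y ∂μ
      ≤ (μ (A ∪ B))⁻¹ * (∫⁻ y in A, g y ∂μ + ∫⁻ y in B, g y ∂μ) := by
        gcongr
        exact lintegral_union_le _ _ _
    _ ≤ _ := by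
        rw [mul_add]
        gcongr
        · exact subset_union_left
        · exact subset_union_right

theorem avg_singleton_le [MeasurableSingletonClass X] (a : X) (g : X → ℝ≥0∞) :
    avg μ {a} g ≤ g a := by
  unfold avg
  rw [lintegral_singleton, mul_left_comm]
  exact mul_le_of_le_one_right' (ENNReal.inv_mul_le_one _)

/-- The mass of `b` is weighed against a lower bound for the mass of `A`. With `b` a hub and `w` the
mass of a far point, the resulting factor is the height of the maximal function of the hub. -/
theorem avg_union_singleton_le [MeasurableSingletonClass X] (A : Set X) (b : X) (g : X → ℝ≥0∞)
    {w : ℝ≥0∞} (hw : w ≤ μ A) :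
    avg μ (A ∪ {b}) g ≤ avg μ A g + g b * (μ {b} / w) := by
  unfold avg
  calc (μ (A ∪ {b}))⁻¹ * ∫⁻ y in A ∪ {b}, g y ∂μ
      ≤ (μ (A ∪ {b}))⁻¹ * (∫⁻ y in A, g y ∂μ + g b * μ {b}) := by
        gcongr
        rw [← lintegral_singleton]
        exact lintegral_union_le _ _ _
    _ ≤ (μ A)⁻¹ * (∫⁻ y in A, g y ∂μ) + w⁻¹ * (g b * μ {b}) := by
        rw [mul_add]
        gcongr
        · exact subset_union_left
        · exact hw.trans (measure_mono subset_union_left)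
    _ = _ := by
        rw [div_eq_mul_inv]
        ring

end Average

/-! ### Constraints on the parameters; finiteness and failure of doubling -/

/-- The parameters of the space: numbers of leaves, masses of the near (`v`) and far (`w`) points,
and exponents `e`, `j` describing the masses of the hubs and of the sets of near points of the
branches. -/
structure StarData (p : ℝ) (β : ℕ → ℝ≥0∞) where
  N : Branch → ℕ
  v : Branch → ℝ≥0∞
  w : Branch → ℝ≥0∞
  e : ℕ → ℕ
  j : Branch → ℕ
  e_inj : Function.Injective e
  j_inj : Function.Injective j
  mass : ∀ a, N a * v a = (half ^ p) ^ j a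
  v_le : ∀ a, v a ≤ w a
  v_ne_zero : ∀ a, v a ≠ 0
  w_ne_top : ∀ a, w a ≠ ∞
  hub_le : ∀ a : Branch, (half ^ p) ^ e a.1 ≤ w a
  -- Height on the branch times 2^(-j a): the weight of one branch in the ℓ^r norm, the same for all
  -- branches of a star.
  ratio : ∀ a : Branch, (half ^ p) ^ e a.1 / w a * half ^ j a = β a.1 * half ^ e a.1
  -- The hub is much lighter than the ring around it, which makes the ring averages summable.
  gap : ∀ n, ∃ i, j ⟨n, i⟩ + n ≤ e n
  -- Besides finite mass, this gives arbitrarily small far points, hence non-doubling.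
  total : ∑' a, N a * w a ≠ ∞
  comparable : p = 1 ∨ ∃ K : ℝ≥0, ∀ a, w a ≤ K * v a

namespace StarData

open Pt

variable {p : ℝ} {β : ℕ → ℝ≥0∞} (D : StarData p β)

/-- The measure of the space. -/
def μ : Measure (Pt D.N) := measure (fun n => (half ^ p) ^ D.e n) D.v D.w

theorem N_pos (a : Branch) : 0 < D.N a := by
  refine Nat.pos_of_ne_zero fun h => ?_
  have := D.mass a
  rw [h, Nat.cast_zero, zero_mul] at this
  refine pow_ne_zero (D.j a) ?_ this.symm
  simp [half]

theorem w_ne_zero (a : Branch) : D.w a ≠ 0 := fun h =>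
  D.v_ne_zero a (le_antisymm (h ▸ D.v_le a) bot_le)

theorem hub_mass_ne_zero (n : ℕ) : (half ^ p) ^ n ≠ 0 := pow_ne_zero _ (by simp [half])

theorem tsum_geom_ne_top (hp : 0 < p) {ι : Type*} {e : ι → ℕ} (he : Function.Injective e) :
    ∑' i, (half ^ p) ^ e i ≠ ∞ := by
  refine ne_top_of_le_ne_top ?_ (ENNReal.tsum_comp_le_tsum_of_injective he fun k => (half ^ p) ^ k)
  rw [ENNReal.tsum_geometric]
  exact geom_const_ne_top hp

theorem measure_univ_ne_top (hp : 0 < p) : D.μ univ ≠ ∞ := by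
  classical
  rw [μ, measure_apply]
  simp only [mem_univ, if_true]
  rw [tsum_leaf D.v, tsum_leaf D.w]
  simp only [D.mass]
  exact ENNReal.add_ne_top.2 ⟨ENNReal.add_ne_top.2 ⟨tsum_geom_ne_top hp D.e_inj,
    tsum_geom_ne_top hp D.j_inj⟩, D.total⟩

theorem measure_singleton_pos (a : Pt D.N) : 0 < D.μ {a} := by
  rw [μ, pos_iff_ne_zero]
  cases a with
  | hub n => rw [measure_hub]; exact hub_mass_ne_zero _
  | near l => rw [measure_near]; exact D.v_ne_zero _
  | far l => rw [measure_far]; exact D.w_ne_zero _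

theorem isFiniteBoundedSpace (hp : 0 < p) : IsFiniteBoundedSpace D.μ where
  bounded := isBounded_univ
  finite := (D.measure_univ_ne_top hp).lt_top
  ball_pos a _ hs := (D.measure_singleton_pos a).trans_le
    (measure_mono (singleton_subset_iff.2 (Metric.mem_ball_self hs)))

/-- Doubling from radius 3/2 to 3 at far points would bound every `w a` below by a fixed multiple of
the total mass, yet the sum of N a w a over infinitely many branches converges. -/
theorem not_isDoubling : ¬ IsDoubling D.μ := by
  rintro ⟨C, hC⟩
  have h1 : ∀ a : Branch, D.μ univ ≤ (C * 2) * D.w a := fun a => by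
    have h := hC (far ⟨a, ⟨0, D.N_pos a⟩⟩) (3 / 2) (by norm_num)
    rw [ball_of_two_lt _ (by norm_num), ball_far _ (by norm_num) (by norm_num)] at h
    refine h.trans ?_
    rw [mul_assoc]
    gcongr
    refine (measure_union_le _ _).trans ?_
    rw [μ, measure_far, measure_near, two_mul]
    gcongr
    exact D.v_le a
  have h2 : ∑' _ : Branch, D.μ univ ≤ (C * 2) * ∑' a, D.N a * D.w a := by
    rw [← ENNReal.tsum_mul_left]
    refine ENNReal.tsum_le_tsum fun a => (h1 a).trans ?_
    gcongr
    exact le_mul_of_one_le_left' (by exact_mod_cast D.N_pos a)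
  have : Infinite Branch := Infinite.of_injective (fun n : ℕ => (⟨n, 0⟩ : Branch)) fun m n h => by
    simpa using congrArg Sigma.fst h
  rw [ENNReal.tsum_const_eq_top_of_ne_zero] at h2
  · exact ENNReal.mul_ne_top (by finiteness) D.total (top_le_iff.1 h2)
  · exact ((D.measure_singleton_pos (hub 0)).trans_le (measure_mono (subset_univ _))).ne'

/-! ### Boundedness of the pieces of the maximal operator -/

/-- An operator `G` is bounded from the Lorentz space with exponents `p`, `q` to the one with
exponents `p`, `r`. -/
def Bdd (q r : ℝ≥0∞) (G : (Pt D.N → ℂ) → Pt D.N → ℝ≥0∞) : Prop :=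
  ∃ C : ℝ≥0, ∀ f : Pt D.N → ℂ, lorentzNorm D.μ p q (fun x => ‖f x‖ₑ) < ∞ →
    lorentzNorm D.μ p r (G f) ≤ C * lorentzNorm D.μ p q (fun x => ‖f x‖ₑ)

variable {D}

theorem Bdd.mono (hp : 1 ≤ p) {q r : ℝ≥0∞} (hr : 1 ≤ r) {G G' : (Pt D.N → ℂ) → Pt D.N → ℝ≥0∞}
    (h : D.Bdd q r G') (hG : ∀ f a, G f a ≤ G' f a) : D.Bdd q r G := by
  obtain ⟨C, hC⟩ := h
  refine ⟨C, fun f hf => le_trans ?_ (hC f hf)⟩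
  exact lorentzFun_mono hp hr fun t _ => measure_mono fun a ha => lt_of_lt_of_le ha (hG f a)

theorem Bdd.add (hp : 1 ≤ p) {q r : ℝ≥0∞} (hr : 1 ≤ r) {G G' : (Pt D.N → ℂ) → Pt D.N → ℝ≥0∞}
    (h : D.Bdd q r G) (h' : D.Bdd q r G') : D.Bdd q r (fun f a => G f a + G' f a) := by
  obtain ⟨C, hC⟩ := h
  obtain ⟨C', hC'⟩ := h'
  refine ⟨4 * (C + C'), fun f hf => ?_⟩
  refine (lorentzFun_add_le hp hr (distribution_antitone D.μ (G f))
    (distribution_antitone D.μ (G' f)) fun t ht => ?_).trans ?_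
  · refine le_trans (measure_mono fun a ha => ?_) (measure_union_le _ _)
    by_contra hcon
    simp only [mem_union, mem_ofPred_eq, not_or, not_lt] at hcon ha
    refine not_le.2 ha ((add_le_add hcon.1 hcon.2).trans ?_)
    rw [← ENNReal.ofReal_add (by positivity) (by positivity), add_halves]
  · push_cast
    rw [mul_assoc, add_mul]
    gcongr
    · exact hC f hf
    · exact hC' f hf

variable (D)

theorem bdd_enorm (hp : 1 ≤ p) {q r : ℝ≥0∞} (hq : 1 ≤ q) (hqr : q ≤ r) :
    D.Bdd q r fun f a => ‖f a‖ₑ := by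
  obtain ⟨C, hC⟩ := exists_lorentzFun_le hp hq hqr
  exact ⟨C, fun f hf => hC _ (distribution_antitone D.μ _) hf⟩

theorem bdd_of_distribution_le (hp : 1 ≤ p) {q r : ℝ≥0∞} (hq : 1 ≤ q) (hqr : q ≤ r)
    {G : (Pt D.N → ℂ) → Pt D.N → ℝ≥0∞} (K : ℝ≥0) (h : ∀ f t, 0 < t →
      distribution D.μ (G f) t ≤ K * distribution D.μ (fun a => ‖f a‖ₑ) t) :
    D.Bdd q r G := by
  obtain ⟨C, hC⟩ := D.bdd_enorm hp hq hqr
  refine ⟨(K ^ (1 / p)) * C, fun f hf => ?_⟩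
  refine (lorentzFun_le_const_mul hp (hq.trans hqr) ENNReal.coe_ne_top (h f)).trans ?_
  rw [ENNReal.coe_mul, ENNReal.coe_rpow_of_nonneg _ (by positivity), mul_assoc]
  gcongr
  exact hC f hf

/-- The branch supplied by `gap` alone gives the ring mass at least 2^(-p (e n - n)). The last bound
is the decay that beats Hölder's inequality in `bdd_ringAverage`. -/
theorem ring_mass (n : ℕ) (hp : 0 < p) : D.μ (ring D.N n) ≠ ∞ ∧ D.μ (ring D.N n) ≠ 0 ∧
    (half ^ D.e n) / D.μ (ring D.N n) ^ (1 / p) ≤ half ^ n := by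
  classical
  obtain ⟨i, hi⟩ := D.gap n
  have h1 : (half ^ p) ^ D.j ⟨n, i⟩ ≤ D.μ (ring D.N n) := by
    rw [μ, measure_apply]
    refine le_trans ?_ (le_add_right le_add_self)
    have h2 : ∀ l : Leaf D.N, (if near l ∈ ring D.N n then D.v l.1 else 0) =
        (fun a : Branch => if a.1 = n then D.v a else 0) l.1 := fun l => by
      have : (near l ∈ ring D.N n) ↔ l.1.1 = n := by
        refine ⟨?_, fun h => ⟨l, h, rfl⟩⟩
        rintro ⟨k, hk, h⟩
        cases h
        exact hk
      simp only [this]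
    simp_rw [h2]
    rw [tsum_leaf (fun a : Branch => if a.1 = n then D.v a else 0)]
    refine le_trans ?_ (ENNReal.le_tsum (⟨n, i⟩ : Branch))
    simp [D.mass]
  have hne : D.μ (ring D.N n) ≠ 0 := fun h0 =>
    hub_mass_ne_zero (p := p) _ (le_antisymm (h0 ▸ h1) bot_le)
  refine ⟨ne_top_of_le_ne_top (D.measure_univ_ne_top hp) (measure_mono (subset_univ _)), hne, ?_⟩
  have h3 := ENNReal.rpow_le_rpow h1 (by positivity : 0 ≤ 1 / p)
  rw [half_pow_rpow_inv hp] at h3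
  refine (ENNReal.div_le_div_left h3 _).trans ?_
  refine ENNReal.div_le_of_le_mul ?_
  rw [← pow_add]
  exact pow_le_pow_right_of_le_one' (by simp [half]) (by omega)

theorem bdd_average (hp : 1 ≤ p) {q r : ℝ≥0∞} (h : (p = 1 ∧ q = 1) ∨ (1 < p ∧ 1 ≤ q))
    (hr : 1 ≤ r) : D.Bdd q r fun f _ => avg D.μ univ fun a => ‖f a‖ₑ := by
  obtain ⟨C, hC⟩ := exists_setLIntegral_le D.μ h
  obtain ⟨A, hA⟩ := exists_lorentzFun_lacDist_le hp hr
  have hp0 : 0 < p := by linarith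
  have hU := D.measure_univ_ne_top hp0
  have hU0 : D.μ univ ≠ 0 :=
    ((D.measure_singleton_pos (hub 0)).trans_le (measure_mono (subset_univ _))).ne'
  set M := D.μ univ with hM
  have hMp : M ^ (1 / p) ≠ ∞ := ENNReal.rpow_ne_top_of_nonneg (by positivity) hU
  have hMp0 : M ^ (1 / p) ≠ 0 := by simp [hU, hU0]
  refine ⟨A * C, fun f hf => ?_⟩
  have h1 : avg D.μ univ (fun a => ‖f a‖ₑ) ≤
      C * (lorentzNorm D.μ p q (fun x => ‖f x‖ₑ) / M ^ (1 / p)) := by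
    have := hC f Measurable.of_discrete univ hU hU0
    rwa [ENNReal.div_eq_inv_mul] at this
  set c := avg D.μ univ fun a => ‖f a‖ₑ with hc
  have hct : c ≠ ∞ := ne_top_of_le_ne_top (ENNReal.mul_ne_top (by simp)
    (ENNReal.div_ne_top hf.ne hMp0)) h1
  -- A constant function is, up to the total mass, a lacunary family with one member of exponent 0.
  have h2 : lorentzNorm D.μ p r (fun _ => c) ≤
      M ^ (1 / p) * lorentzFun p r (lacDist p (fun _ : Unit => 0) fun _ => c) := by
    refine lorentzFun_le_const_mul hp hr hU fun t _ => ?_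
    simp only [distribution, lacDist, tsum_fintype, Finset.univ_unique, Finset.sum_singleton,
      pow_zero]
    split_ifs with ht
    · rw [mul_one]
      exact measure_mono (subset_univ _)
    · simp [ht]
  have h3 := hA Unit (fun _ => 0) (fun _ => c) (fun _ _ _ => rfl) fun _ => hct
  have h4 : seqNorm r (fun _ : Unit => c * half ^ 0) = c := by
    simp only [pow_zero, mul_one]
    unfold seqNorm
    split_ifs with hri
    · simp
    · have hρ : 0 < r.toReal := ENNReal.toReal_pos (by positivity) hri
      simp [← ENNReal.rpow_mul, hρ.ne']
  rw [h4] at h3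
  calc _ ≤ M ^ (1 / p) * (A * (C * (lorentzNorm D.μ p q (fun x => ‖f x‖ₑ) / M ^ (1 / p)))) := by
        refine h2.trans ?_
        gcongr
        exact h3.trans (by gcongr)
    _ = A * C * (M ^ (1 / p) * (lorentzNorm D.μ p q (fun x => ‖f x‖ₑ) / M ^ (1 / p))) := by ring
    _ = _ := by
        rw [ENNReal.mul_div_cancel hMp0 hMp]
        push_cast
        rfl

/-- The averages over the rings, as a function supported on the hubs. -/
def ringAverage (f : Pt D.N → ℂ) : Pt D.N → ℝ≥0∞
  | hub n => avg D.μ (ring D.N n) fun a => ‖f a‖ₑ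
  | _ => 0

/-- The contribution of the hubs to the averages around the near points. -/
def hubPart (f : Pt D.N → ℂ) : Pt D.N → ℝ≥0∞
  | near l => ‖f (hub l.1.1)‖ₑ * ((half ^ p) ^ D.e l.1.1 / D.w l.1)
  | _ => 0

/-- The contribution of the far points to the averages around the near points. -/
def farPart (f : Pt D.N → ℂ) : Pt D.N → ℝ≥0∞
  | near l => ‖f (far l)‖ₑ
  | _ => 0

/-- The contribution of the near points to the averages around the far points. -/
def nearPart (f : Pt D.N → ℂ) : Pt D.N → ℝ≥0∞
  | far l => ‖f (near l)‖ₑ * (D.v l.1 / D.w l.1)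
  | _ => 0

theorem seqNorm_geom_ne_top {r : ℝ≥0∞} (hr : 1 ≤ r) : seqNorm r (fun n : ℕ => half ^ n) ≠ ∞ := by
  unfold seqNorm
  split_ifs with h
  · refine ne_top_of_le_ne_top ENNReal.one_ne_top (iSup_le fun n => ?_)
    exact pow_le_one' (by simp [half]) n
  · have hρ : 0 < r.toReal := ENNReal.toReal_pos (by positivity) h
    refine ENNReal.rpow_ne_top_of_nonneg (by positivity) ?_
    have : ∀ n : ℕ, (half ^ n) ^ r.toReal = (half ^ r.toReal) ^ n := fun n => by
      rw [← ENNReal.rpow_natCast, ← ENNReal.rpow_natCast, ← ENNReal.rpow_mul, ← ENNReal.rpow_mul,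
        mul_comm]
    simp_rw [this, ENNReal.tsum_geometric]
    exact geom_const_ne_top hρ

/-- The averages live on the hubs, whose masses are lacunary. By Hölder and `ring_mass` the n-th
term is at most a constant times 2^(-n) times the norm of f, which is in ℓ^r. -/
theorem bdd_ringAverage (hp : 1 ≤ p) {q r : ℝ≥0∞} (h : (p = 1 ∧ q = 1) ∨ (1 < p ∧ 1 ≤ q))
    (hr : 1 ≤ r) : D.Bdd q r D.ringAverage := by
  obtain ⟨C, hC⟩ := exists_setLIntegral_le D.μ h
  obtain ⟨A, hA⟩ := exists_lorentzFun_lacDist_le hp hr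
  have hp0 : 0 < p := by linarith
  have hS := seqNorm_geom_ne_top hr
  set S := seqNorm r (fun n : ℕ => half ^ n) with hSdef
  refine ⟨A * (C * S.toNNReal), fun f hf => ?_⟩
  set L := lorentzNorm D.μ p q (fun x => ‖f x‖ₑ) with hL
  set m : ℕ → ℝ≥0∞ := fun n => D.μ (ring D.N n) with hm
  have hmp0 : ∀ n, m n ^ (1 / p) ≠ 0 := fun n => by
    simp [hm, (D.ring_mass n hp0).1, (D.ring_mass n hp0).2.1]
  have h1 : ∀ n, D.ringAverage f (hub n) ≤ C * (L / m n ^ (1 / p)) := fun n => by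
    have := hC f Measurable.of_discrete _ (D.ring_mass n hp0).1 (D.ring_mass n hp0).2.1
    rwa [ENNReal.div_eq_inv_mul] at this
  have h2 : distribution D.μ (D.ringAverage f) =
      lacDist p D.e fun n => D.ringAverage f (hub n) := by
    ext t
    rw [μ, distribution_measure]
    simp [ringAverage, lacDist]
  rw [lorentzNorm_eq_lorentzFun, h2]
  refine (hA ℕ D.e _ D.e_inj fun n => ?_).trans ?_
  · exact ne_top_of_le_ne_top (ENNReal.mul_ne_top (by simp) (ENNReal.div_ne_top hf.ne (hmp0 n)))
      (h1 n)
  · rw [ENNReal.coe_mul, ENNReal.coe_mul, ENNReal.coe_toNNReal hS, mul_assoc]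
    gcongr
    rw [mul_right_comm, hSdef, ← seqNorm_const_mul hr]
    refine seqNorm_mono fun n => ?_
    calc _ ≤ C * (L / m n ^ (1 / p)) * half ^ D.e n := by
          gcongr
          exact h1 n
      _ = C * L * (half ^ D.e n / m n ^ (1 / p)) := by
          simp only [div_eq_mul_inv]
          ring
      _ ≤ _ := by
          gcongr
          exact (D.ring_mass n hp0).2.2

/-- Values move from far points to near points of no larger mass, so the distribution does not grow.
-/
theorem bdd_farPart (hp : 1 ≤ p) {q r : ℝ≥0∞} (hq : 1 ≤ q) (hqr : q ≤ r) :
    D.Bdd q r D.farPart := by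
  refine D.bdd_of_distribution_le hp hq hqr 1 fun f t _ => ?_
  rw [μ, distribution_measure, distribution_measure, ENNReal.coe_one, one_mul]
  refine le_trans ?_ le_add_self
  simp only [farPart, not_lt_zero, if_false, tsum_zero, zero_add, add_zero]
  refine ENNReal.tsum_le_tsum fun l => ?_
  by_cases h : ENNReal.ofReal t < ‖f (far l)‖ₑ
  · exact (if_pos h).trans_le ((D.v_le _).trans (if_pos h).ge)
  · exact (if_neg h).trans_le bot_le

/-- For p = 1 the factor v / w compensates the change of mass, so the L^1 norm does not grow. For p
> 1 the masses are comparable, and the distribution grows at most by a constant. -/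
theorem bdd_nearPart (hp : 1 ≤ p) {q r : ℝ≥0∞} (h : (p = 1 ∧ q = 1) ∨ (1 < p ∧ 1 ≤ q))
    (hqr : q ≤ r) : D.Bdd q r D.nearPart := by
  have hq : 1 ≤ q := by
    rcases h with h | h
    · exact h.2.ge
    · exact h.2
  have hvw : ∀ a, D.v a / D.w a ≤ 1 := fun a => ENNReal.div_le_of_le_mul (by simpa using D.v_le a)
  rcases h with ⟨rfl, rfl⟩ | ⟨hp1, -⟩
  · obtain ⟨C, hC⟩ := exists_lorentzFun_le le_rfl hq hqr
    refine ⟨C, fun f hf => ?_⟩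
    have hle : lorentzNorm D.μ 1 1 (D.nearPart f) ≤ lorentzNorm D.μ 1 1 (fun x => ‖f x‖ₑ) := by
      rw [lorentzNorm_eq_lorentzFun, lorentzNorm_eq_lorentzFun, lorentzFun_one_one,
        lorentzFun_one_one,
        ← lintegral_eq_lintegral_distribution _ Measurable.of_discrete,
        ← lintegral_eq_lintegral_distribution _ Measurable.of_discrete, μ, lintegral_measure,
        lintegral_measure]
      · refine le_trans ?_ (le_add_right le_add_self)
        simp only [nearPart, mul_zero, tsum_zero, zero_add]
        refine ENNReal.tsum_le_tsum fun l => le_of_eq ?_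
        rw [mul_left_comm, ENNReal.mul_div_cancel (D.w_ne_zero _) (D.w_ne_top _), mul_comm]
      · exact fun _ => enorm_ne_top
      · intro a
        cases a with
        | far l => exact ENNReal.mul_ne_top enorm_ne_top ((hvw _).trans_lt (by simp)).ne
        | _ => simp [nearPart]
    refine (hC _ (distribution_antitone D.μ _) (hle.trans_lt hf)).trans ?_
    rw [← lorentzNorm_eq_lorentzFun]
    gcongr
  · obtain ⟨K, hK⟩ := D.comparable.resolve_left hp1.ne'
    refine D.bdd_of_distribution_le hp hq hqr K fun f t _ => ?_
    rw [μ, distribution_measure, distribution_measure]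
    refine le_trans ?_ (mul_le_mul_right (le_add_right le_add_self) _)
    simp only [nearPart, not_lt_zero, if_false, tsum_zero, zero_add]
    rw [← ENNReal.tsum_mul_left]
    exact ENNReal.tsum_le_tsum fun l =>
      ite_le_mul_ite (fun h1 => h1.trans_le (mul_le_of_le_one_right' (hvw _))) (hK _)

theorem seqNorm_branch_le {r : ℝ≥0∞} (hr : 1 ≤ r) (b : ℕ → ℝ≥0∞) :
    seqNorm r (fun a : Branch => b a.1) ≤
      seqNorm r fun n : ℕ => ((n : ℝ≥0∞) + 1) ^ (1 / r.toReal) * b n := by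
  unfold seqNorm
  split_ifs with h
  · refine iSup_le fun a => ?_
    refine le_trans ?_ (le_iSup _ a.1)
    simp [h]
  · have hρ : 0 < r.toReal := ENNReal.toReal_pos (by positivity) h
    rw [ENNReal.tsum_sigma' (f := fun a : Branch => b a.1 ^ r.toReal)]
    gcongr with n
    rw [ENNReal.mul_rpow_of_nonneg _ _ hρ.le, ← ENNReal.rpow_mul, one_div_mul_cancel hρ.ne']
    simp

/-- The only piece that needs a condition on β. By `ratio` the lacunary terms are β n |f(hub n)|
2^(-e n), each repeated n + 1 times, whence the factor (n + 1)^(1/r); what remains is bounded by the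
L^{p,r} norm of f restricted to the hubs. -/
theorem bdd_hubPart (hp : 1 ≤ p) {q r : ℝ≥0∞} (hq : 1 ≤ q) (hqr : q ≤ r) {C₀ : ℝ≥0}
    (hβ : ∀ n : ℕ, β n * ((n : ℝ≥0∞) + 1) ^ (1 / r.toReal) ≤ C₀) : D.Bdd q r D.hubPart := by
  have hr := hq.trans hqr
  obtain ⟨C, hC⟩ := exists_lorentzFun_le hp hq hqr
  obtain ⟨A, hA⟩ := exists_lorentzFun_lacDist_le hp hr
  obtain ⟨B, hB⟩ := exists_seqNorm_le_lorentzFun hp hr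
  refine ⟨A * (C₀ * (B * C)), fun f hf => ?_⟩
  have h2 : distribution D.μ (D.hubPart f) = lacDist p D.j fun a : Branch =>
      ‖f (hub a.1)‖ₑ * ((half ^ p) ^ D.e a.1 / D.w a) := by
    ext t
    rw [μ, distribution_measure]
    simp only [hubPart, not_lt_zero, if_false, tsum_zero, zero_add, add_zero, lacDist]
    refine (tsum_leaf fun a : Branch => if ENNReal.ofReal t < ‖f (hub a.1)‖ₑ *
      ((half ^ p) ^ D.e a.1 / D.w a) then D.v a else 0).trans ?_
    refine tsum_congr fun a => ?_
    rw [mul_ite, mul_zero, D.mass]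
  rw [lorentzNorm_eq_lorentzFun, h2]
  refine (hA Branch D.j _ D.j_inj fun a => ?_).trans ?_
  · exact ENNReal.mul_ne_top enorm_ne_top ((ENNReal.div_le_of_le_mul
      (by simpa using D.hub_le a)).trans_lt ENNReal.one_lt_top).ne
  push_cast
  rw [mul_assoc, mul_assoc, mul_assoc]
  gcongr
  have h3 : ∀ a : Branch, ‖f (hub a.1)‖ₑ * ((half ^ p) ^ D.e a.1 / D.w a) * half ^ D.j a =
      β a.1 * (‖f (hub a.1)‖ₑ * half ^ D.e a.1) := fun a => by
    rw [mul_assoc, D.ratio, mul_left_comm]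
  simp_rw [h3]
  refine (seqNorm_branch_le hr fun n => β n * (‖f (hub n)‖ₑ * half ^ D.e n)).trans ?_
  calc _ ≤ seqNorm r fun n : ℕ => C₀ * (‖f (hub n)‖ₑ * half ^ D.e n) := by
        refine seqNorm_mono fun n => ?_
        rw [← mul_assoc, mul_comm _ (β n)]
        gcongr
        exact hβ n
    _ = C₀ * seqNorm r fun n : ℕ => ‖f (hub n)‖ₑ * half ^ D.e n := seqNorm_const_mul hr _ _
    _ ≤ _ := by
        gcongr
        refine (hB ℕ D.e (fun n => ‖f (hub n)‖ₑ) (distribution D.μ fun a => ‖f a‖ₑ) D.e_inj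
          (fun _ => enorm_ne_top) fun t _ => ?_).trans ?_
        · rw [μ, distribution_measure]
          exact le_add_right le_self_add
        · gcongr
          exact hC _ (distribution_antitone D.μ _) hf

theorem avg_ball_le (f : Pt D.N → ℂ) (a : Pt D.N) {s : ℝ} (hs : 1 < s) (hs2 : s ≤ 2) :
    avg D.μ (Metric.ball a s) (fun b => ‖f b‖ₑ) ≤
      ‖f a‖ₑ + D.ringAverage f a + D.farPart f a + D.nearPart f a + D.hubPart f a := by
  cases a with
  | hub n =>
    rw [ball_hub n hs hs2]
    simp only [ringAverage, farPart, nearPart, hubPart, add_zero]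
    rw [add_comm]
    exact (avg_union_le _ _ _ _).trans (add_le_add le_rfl (avg_singleton_le _ _ _))
  | near l =>
    rw [ball_near l hs hs2]
    simp only [ringAverage, farPart, nearPart, hubPart, add_zero]
    have h := avg_union_singleton_le D.μ ({near l} ∪ {far l}) (hub l.1.1) (fun b => ‖f b‖ₑ)
      (w := D.w l.1) (by
        refine le_trans ?_ (measure_mono subset_union_right)
        rw [μ, measure_far])
    refine h.trans ?_
    rw [show D.μ {hub l.1.1} = (half ^ p) ^ D.e l.1.1 by rw [μ, measure_hub]]
    gcongr
    exact (avg_union_le _ _ _ _).trans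
      (add_le_add (avg_singleton_le _ _ _) (avg_singleton_le _ _ _))
  | far l =>
    rw [ball_far l hs hs2]
    simp only [ringAverage, farPart, nearPart, hubPart, add_zero]
    have h := avg_union_singleton_le D.μ {far l} (near l) (fun b => ‖f b‖ₑ)
      (w := D.w l.1) (by rw [μ, measure_far])
    refine h.trans ?_
    rw [show D.μ {near l} = D.v l.1 by rw [μ, measure_near]]
    gcongr
    exact avg_singleton_le _ _ _

theorem maximal_le (f : Pt D.N → ℂ) (a : Pt D.N) :
    maximal D.μ f a ≤ (‖f a‖ₑ + D.ringAverage f a + D.farPart f a + D.nearPart f a +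
      D.hubPart f a) + avg D.μ univ fun b => ‖f b‖ₑ := by
  refine iSup₂_le fun s hs => ?_
  change avg D.μ (Metric.ball a s) (fun b => ‖f b‖ₑ) ≤ _
  rcases le_or_gt s 1 with h1 | h1
  · rw [ball_of_le_one a hs h1]
    refine (avg_singleton_le _ _ _).trans ?_
    simp only [add_assoc]
    exact le_self_add
  · rcases le_or_gt s 2 with h2 | h2
    · exact le_add_right (D.avg_ball_le f a h1 h2)
    · rw [ball_of_two_lt a h2]
      exact le_add_self

theorem bdd_maximal (hp : 1 ≤ p) {q r : ℝ≥0∞} (h : (p = 1 ∧ q = 1) ∨ (1 < p ∧ 1 ≤ q))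
    (hqr : q ≤ r) {C₀ : ℝ≥0}
    (hβ : ∀ n : ℕ, β n * ((n : ℝ≥0∞) + 1) ^ (1 / r.toReal) ≤ C₀) : D.Bdd q r (maximal D.μ) := by
  have hq : 1 ≤ q := by
    rcases h with h | h
    · exact h.2.ge
    · exact h.2
  have hr := hq.trans hqr
  refine Bdd.mono hp hr ?_ D.maximal_le
  exact (((((D.bdd_enorm hp hq hqr).add hp hr (D.bdd_ringAverage hp h hr)).add hp hr
    (D.bdd_farPart hp hq hqr)).add hp hr (D.bdd_nearPart hp h hqr)).add hp hr
    (D.bdd_hubPart hp hq hqr hβ)).add hp hr (D.bdd_average hp h hr)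

/-! ### The best constant, and necessity of the condition on β -/

theorem bestConst_lt_top_iff (q r : ℝ≥0∞) :
    bestConst D.μ p q r < ∞ ↔ D.Bdd q r (maximal D.μ) := by
  unfold bestConst
  simp only [iInf_lt_iff]
  constructor
  · rintro ⟨c, h, -⟩
    exact ⟨c, fun f hf => h f Measurable.of_discrete hf⟩
  · rintro ⟨c, h⟩
    exact ⟨c, fun f _ hf => h f hf, ENNReal.coe_lt_top⟩

/-- The ball of radius 3/2 has three points, each of mass at most `w`; hence the 3. -/
theorem le_maximal_near (f : Pt D.N → ℂ) (l : Leaf D.N) (hf : ‖f (hub l.1.1)‖ₑ = 1) :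
    (3 : ℝ≥0∞)⁻¹ * ((half ^ p) ^ D.e l.1.1 / D.w l.1) ≤ maximal D.μ f (near l) := by
  refine le_trans ?_ (le_iSup₂ (f := fun (s : ℝ) (_ : 0 < s) =>
    (D.μ (Metric.ball (near l) s))⁻¹ * ∫⁻ y in Metric.ball (near l) s, ‖f y‖ₑ ∂D.μ)
    (3 / 2) (by norm_num))
  rw [ball_near l (by norm_num) (by norm_num)]
  have h1 : D.μ (({near l} ∪ {far l}) ∪ {hub l.1.1}) ≤ 3 * D.w l.1 := by
    refine (measure_union_le _ _).trans ((add_le_add_left (measure_union_le _ _) _).trans ?_)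
    rw [μ, measure_near, measure_far, measure_hub]
    calc _ ≤ D.w l.1 + D.w l.1 + D.w l.1 := by
          gcongr
          · exact D.v_le _
          · exact D.hub_le _
      _ = _ := by ring
  have h2 : (half ^ p) ^ D.e l.1.1 ≤
      ∫⁻ y in ({near l} ∪ {far l}) ∪ {hub l.1.1}, ‖f y‖ₑ ∂D.μ := by
    refine le_trans ?_ (lintegral_mono_set subset_union_right)
    rw [lintegral_singleton, hf, one_mul, μ, measure_hub]
  calc _ = (3 * D.w l.1)⁻¹ * (half ^ p) ^ D.e l.1.1 := by
        rw [ENNReal.mul_inv (by simp) (by simp), div_eq_mul_inv]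
        ring
    _ ≤ _ := by
        gcongr

/-- The test function is the indicator of hub n, with norm at most a constant times 2^(-e n). Its
maximal function contributes n + 1 equal terms to the lacunary ℓ^r norm. -/
theorem exists_le_of_bdd_maximal (hp : 1 ≤ p) {q r : ℝ≥0∞} (hq : 1 ≤ q) (hr : 1 ≤ r)
    (h : D.Bdd q r (maximal D.μ)) :
    ∃ C₀ : ℝ≥0, ∀ n : ℕ, β n * ((n : ℝ≥0∞) + 1) ^ (1 / r.toReal) ≤ C₀ := by
  classical
  obtain ⟨C, hC⟩ := h
  obtain ⟨A, hA⟩ := exists_lorentzFun_lacDist_le hp hq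
  obtain ⟨B, hB⟩ := exists_seqNorm_le_lorentzFun hp hr
  have hp0 : 0 < p := by linarith
  refine ⟨3 * (B * (C * A)), fun n => ?_⟩
  set f : Pt D.N → ℂ := Set.indicator {hub n} 1 with hf
  have hn : half ^ D.e n ≠ 0 := pow_ne_zero _ half_ne_zero
  have hnt : half ^ D.e n ≠ ∞ := ENNReal.pow_ne_top half_ne_top
  have hdf : distribution D.μ (fun x => ‖f x‖ₑ) =
      lacDist p (fun _ : Unit => D.e n) fun _ => 1 := by
    ext t
    rw [μ, distribution_measure, tsum_eq_single n]
    · simp [hf, lacDist]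
    · intro m hm
      simp [hf, hm]
  have h1 : lorentzNorm D.μ p q (fun x => ‖f x‖ₑ) ≤ A * half ^ D.e n := by
    rw [lorentzNorm_eq_lorentzFun, hdf]
    refine (hA Unit _ _ (fun _ _ _ => rfl) (by simp)).trans (le_of_eq ?_)
    congr 1
    simp only [one_mul]
    unfold seqNorm
    split_ifs with hqi
    · simp
    · have hρ : 0 < q.toReal := ENNReal.toReal_pos (by positivity) hqi
      simp [← ENNReal.rpow_mul, hρ.ne']
  have h2 := hC f (h1.trans_lt (ENNReal.mul_lt_top (by simp) hnt.lt_top))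
  set τ : Fin (n + 1) → ℝ≥0∞ := fun i =>
    (3 : ℝ≥0∞)⁻¹ * ((half ^ p) ^ D.e n / D.w ⟨n, i⟩) with hτ
  have hinj : Function.Injective fun i : Fin (n + 1) => (⟨n, i⟩ : Branch) := fun i k hik => by
    simpa using hik
  have h3 := hB (Fin (n + 1)) (fun i => D.j ⟨n, i⟩) τ (distribution D.μ (maximal D.μ f))
    (D.j_inj.comp hinj) (fun i => ENNReal.mul_ne_top (by simp) ((ENNReal.div_le_of_le_mul
      (by simpa using D.hub_le ⟨n, i⟩)).trans_lt ENNReal.one_lt_top).ne) (by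
    intro t _
    rw [μ, distribution_measure]
    refine le_trans ?_ (le_add_right le_add_self)
    let φ : Branch → ℝ≥0∞ := fun a => if a.1 = n ∧ ENNReal.ofReal t <
      (3 : ℝ≥0∞)⁻¹ * ((half ^ p) ^ D.e n / D.w a) then D.v a else 0
    calc lacDist p (fun i => D.j ⟨n, i⟩) τ t
        = ∑' i : Fin (n + 1), (fun a : Branch => D.N a * φ a) ⟨n, i⟩ := by
          refine tsum_congr fun i => ?_
          simp only [φ, hτ, true_and, mul_ite, mul_zero, D.mass]
      _ ≤ ∑' a, D.N a * φ a := ENNReal.tsum_comp_le_tsum_of_injective hinj _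
      _ = ∑' l : Leaf D.N, φ l.1 := (tsum_leaf φ).symm
      _ ≤ _ := by
          refine ENNReal.tsum_le_tsum fun l => ?_
          simp only [φ]
          split_ifs with h4 h5 h5
          · exact le_rfl
          · refine absurd (lt_of_lt_of_le h4.2 ?_) h5
            have := D.le_maximal_near f l (by simp [hf, h4.1])
            rwa [h4.1] at this
          · exact bot_le
          · exact bot_le)
  have h4 : ∀ i, τ i * half ^ D.j ⟨n, i⟩ = 3⁻¹ * (β n * half ^ D.e n) := fun i => by
    rw [hτ]
    simp only
    rw [mul_assoc, D.ratio ⟨n, i⟩]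
  simp_rw [h4] at h3
  rw [seqNorm_fin_const hr] at h3
  have h5 : β n * ((n : ℝ≥0∞) + 1) ^ (1 / r.toReal) * half ^ D.e n ≤
      (3 * (B * (C * A))) * half ^ D.e n := by
    calc _ = 3 * (((n : ℝ≥0∞) + 1) ^ (1 / r.toReal) * (3⁻¹ * (β n * half ^ D.e n))) := by
          have h33 : (3 : ℝ≥0∞) * 3⁻¹ = 1 := ENNReal.mul_inv_cancel (by simp) (by simp)
          calc _ = (3 * 3⁻¹) * (β n * ((n : ℝ≥0∞) + 1) ^ (1 / r.toReal) * half ^ D.e n) := by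
                rw [h33, one_mul]
            _ = _ := by ring
      _ ≤ 3 * (B * (C * (A * half ^ D.e n))) := by
          refine mul_le_mul_right (h3.trans (mul_le_mul_right (h2.trans ?_) _)) _
          exact mul_le_mul_right h1 _
      _ = _ := by ring
  push_cast
  exact (ENNReal.mul_le_mul_iff_left hn hnt).1 h5

end StarData

/-! ### Existence of the parameters -/

theorem half_rpow_pow (p : ℝ) (m : ℕ) :
    (half ^ p) ^ m = ENNReal.ofReal (((2 : ℝ)⁻¹ ^ p) ^ m) := by
  rw [half, ENNReal.ofReal_pow (by positivity), ← ENNReal.ofReal_rpow_of_pos (by norm_num),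
    ENNReal.ofReal_inv_of_pos (by norm_num), ENNReal.ofReal_ofNat]

theorem half_pow (m : ℕ) : half ^ m = ENNReal.ofReal ((2 : ℝ)⁻¹ ^ m) := by
  rw [half, ENNReal.ofReal_pow (by positivity), ENNReal.ofReal_inv_of_pos (by norm_num),
    ENNReal.ofReal_ofNat]

/-- The values for n lie in [(n+2)² - n, (n+2)²], and these intervals are disjoint. -/
theorem add_two_sq_sub_injective :
    Function.Injective fun a : Branch => (a.1 + 2) ^ 2 - (a.2 : ℕ) := by
  have hlt : ∀ (n m i k : ℕ), n < m → i ≤ n → k ≤ m → (n + 2) ^ 2 - i < (m + 2) ^ 2 - k := by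
    intro n m i k hnm _ hk
    have : (n + 2) ^ 2 + m < (m + 2) ^ 2 := by nlinarith
    omega
  rintro ⟨n, i⟩ ⟨m, k⟩ h
  simp only at h
  have hi : (i : ℕ) ≤ n := Nat.lt_succ_iff.1 i.2
  have hk : (k : ℕ) ≤ m := Nat.lt_succ_iff.1 k.2
  obtain rfl : n = m := by
    rcases lt_trichotomy n m with hnm | hnm | hnm
    · exact absurd h (hlt n m i k hnm hi hk).ne
    · exact hnm
    · exact absurd h (hlt m n k i hnm hk hi).ne'
  have : n ≤ (n + 2) ^ 2 := by nlinarith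
  have hik : i = k := Fin.ext (by omega)
  rw [hik]

/-- For p > 1 the integer `d` stretches the exponents so that 2^((p-1) d n) ≥ 2^n outweighs a lower
bound 1 / (n + 1). -/
theorem exists_nat_two_le_rpow {p : ℝ} (hp : 1 ≤ p) :
    ∃ d : ℕ, 1 ≤ d ∧ (p = 1 ∨ (1 < p ∧ 1 ≤ (p - 1) * d)) := by
  rcases hp.eq_or_lt with h | h
  · exact ⟨1, le_rfl, Or.inl h.symm⟩
  · obtain ⟨d, hd⟩ := exists_nat_ge (1 / (p - 1))
    have hp1 : 0 < p - 1 := by linarith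
    rw [div_le_iff₀ hp1] at hd
    refine ⟨d, Nat.one_le_iff_ne_zero.2 fun h0 => ?_, Or.inr ⟨h, by linarith⟩⟩
    rw [h0] at hd
    norm_num at hd

theorem tsum_branch_half_ne_top : ∑' a : Branch, half ^ (a.1 + (a.2 : ℕ)) ≠ ∞ := by
  have hS : ∑' n : ℕ, half ^ n ≠ ∞ := by
    rw [ENNReal.tsum_geometric]
    simpa using geom_const_ne_top one_pos
  refine ne_top_of_le_ne_top (ENNReal.mul_ne_top hS hS) ?_
  rw [ENNReal.tsum_sigma' (f := fun a : Branch => half ^ (a.1 + (a.2 : ℕ))),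
    ← ENNReal.tsum_mul_right]
  refine ENNReal.tsum_le_tsum fun n => ?_
  simp only [pow_add]
  rw [ENNReal.tsum_mul_left]
  gcongr
  exact ENNReal.tsum_comp_le_tsum_of_injective Fin.val_injective fun k => half ^ k

theorem natCast_succ_le_two_pow (n : ℕ) : (n : ℝ) + 1 ≤ 2 ^ n := by
  exact_mod_cast Nat.lt_two_pow_self (n := n)

theorem exists_starData {p : ℝ} (hp : 1 ≤ p) (b : ℕ → ℝ) (hb : ∀ n : ℕ, 1 / ((n : ℝ) + 1) ≤ b n)
    (hb' : ∀ n : ℕ, b n ≤ (n : ℝ) + 1) :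
    Nonempty (StarData p fun n => ENNReal.ofReal (b n)) := by
  obtain ⟨d, hd1, hd⟩ := exists_nat_two_le_rpow hp
  have hb0 : ∀ n, 0 < b n := fun n => lt_of_lt_of_le (by positivity) (hb n)
  set u : ℝ := (2 : ℝ)⁻¹ ^ p with hu
  have hu0 : 0 < u := by positivity
  have hu1 : u ≤ 2⁻¹ := by
    conv_rhs => rw [← Real.rpow_one (2⁻¹ : ℝ)]
    exact Real.rpow_le_rpow_of_exponent_ge (by norm_num) (by norm_num) hp
  -- The exponents satisfy e = j + k, with k ≥ n and all j distinct.
  let k : Branch → ℕ := fun a => d * a.1 + a.2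
  let e : ℕ → ℕ := fun n => (n + 2) ^ 2 + d * n
  let j : Branch → ℕ := fun a => (a.1 + 2) ^ 2 - a.2
  have hi : ∀ a : Branch, (a.2 : ℕ) ≤ a.1 := fun a => Nat.lt_succ_iff.1 a.2.2
  have hjk : ∀ a, e a.1 = j a + k a := fun a => by
    have h1 := hi a
    have h2 : a.1 ≤ (a.1 + 2) ^ 2 := by nlinarith
    simp only [e, j, k]
    omega
  have hnk : ∀ a : Branch, a.1 ≤ k a := fun a =>
    (Nat.le_mul_of_pos_left _ hd1).trans (Nat.le_add_right _ _)
  -- The real number of leaves that would make near and far masses equal. Rounding it up to `N`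
  -- makes V ≤ W.
  let x : Branch → ℝ := fun a => (2 : ℝ) ^ ((p - 1) * k a) * b a.1
  have hx0 : ∀ a, 0 < x a := fun a => mul_pos (by positivity) (hb0 _)
  have hxb : ∀ a, b a.1 ≤ x a := fun a => by
    refine le_mul_of_one_le_left (hb0 _).le (Real.one_le_rpow (by norm_num) ?_)
    exact mul_nonneg (by linarith) (Nat.cast_nonneg _)
  let N : Branch → ℕ := fun a => ⌈x a⌉₊
  have hxN : ∀ a, x a ≤ N a := fun a => Nat.le_ceil _
  have hNx : ∀ a, (N a : ℝ) ≤ x a + 1 := fun a => (Nat.ceil_lt_add_one (hx0 a).le).le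
  have hN0 : ∀ a, (0 : ℝ) < N a := fun a => (hx0 a).trans_le (hxN a)
  -- Forced by `ratio`: u^e / W times 2^(-j) is b 2^(-k-j) = b 2^(-e).
  let W : Branch → ℝ := fun a => u ^ e a.1 * 2 ^ k a / b a.1
  let V : Branch → ℝ := fun a => u ^ j a / N a
  have hW0 : ∀ a, 0 < W a := fun a => div_pos (by positivity) (hb0 _)
  have hV0 : ∀ a, 0 < V a := fun a => div_pos (by positivity) (hN0 _)
  have hVW : ∀ a, V a * N a = W a * x a := fun a => by
    have h1 : u ^ k a * ((2 : ℝ) ^ k a * (2 : ℝ) ^ ((p - 1) * k a)) = 1 := by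
      rw [hu, ← Real.rpow_natCast (2 : ℝ), ← Real.rpow_natCast ((2 : ℝ)⁻¹ ^ p),
        ← Real.rpow_add (by norm_num), ← Real.rpow_mul (by norm_num), Real.inv_rpow (by norm_num),
        show (k a : ℝ) + (p - 1) * k a = p * k a by ring]
      exact inv_mul_cancel₀ (by positivity)
    have hb1 := (hb0 a.1).ne'
    have hN1 := (hN0 a).ne'
    calc V a * N a = u ^ j a := div_mul_cancel₀ _ hN1
      _ = u ^ j a * (u ^ k a * ((2 : ℝ) ^ k a * (2 : ℝ) ^ ((p - 1) * k a))) := by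
        rw [h1, mul_one]
      _ = W a * x a := by
        simp only [W, x, hjk, pow_add]
        field_simp
  have hVle : ∀ a, V a ≤ W a := fun a => by
    refine le_of_mul_le_mul_right ?_ (hN0 a)
    rw [hVW]
    exact mul_le_mul_of_nonneg_left (hxN a) (hW0 a).le
  have hue : ∀ n, (half ^ p) ^ n = ENNReal.ofReal (u ^ n) := half_rpow_pow p
  refine ⟨{
    N := N
    v := fun a => ENNReal.ofReal (V a)
    w := fun a => ENNReal.ofReal (W a)
    e := e
    j := j
    e_inj := StrictMono.injective (strictMono_nat_of_lt_succ fun n => ?_)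
    j_inj := add_two_sq_sub_injective
    mass := fun a => ?_
    v_le := fun a => ENNReal.ofReal_le_ofReal (hVle a)
    v_ne_zero := fun a => by simpa using hV0 a
    w_ne_top := fun a => ENNReal.ofReal_ne_top
    hub_le := fun a => ?_
    ratio := fun a => ?_
    gap := fun n => ⟨Fin.last n, ?_⟩
    total := ne_top_of_le_ne_top tsum_branch_half_ne_top (ENNReal.tsum_le_tsum fun a => ?_)
    comparable := ?_ }⟩
  · simp only [e]
    nlinarith
  · rw [hue, ← ENNReal.ofReal_natCast, ← ENNReal.ofReal_mul (hN0 a).le,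
      mul_div_cancel₀ _ (hN0 a).ne']
  · rw [hue]
    refine ENNReal.ofReal_le_ofReal ?_
    rw [le_div_iff₀ (hb0 _)]
    gcongr
    refine (hb' a.1).trans ((natCast_succ_le_two_pow a.1).trans ?_)
    exact pow_le_pow_right₀ (by norm_num) (hnk a)
  · rw [hue, half_pow, half_pow, ← ENNReal.ofReal_div_of_pos (hW0 a),
      ← ENNReal.ofReal_mul (by have := hW0 a; positivity), ← ENNReal.ofReal_mul (hb0 _).le]
    congr 1
    have hb1 := (hb0 a.1).ne'
    have h2 : (2 : ℝ)⁻¹ ^ e a.1 = 2⁻¹ ^ j a * 2⁻¹ ^ k a := by rw [hjk, pow_add]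
    have h3 : (2 : ℝ)⁻¹ ^ k a * 2 ^ k a = 1 := by rw [← mul_pow]; norm_num
    have h4 : u ^ e a.1 ≠ 0 := by positivity
    rw [h2]
    simp only [W]
    rw [div_div_eq_mul_div, mul_div_mul_left _ _ h4, div_mul_eq_mul_div,
      div_eq_iff (by positivity)]
    calc b a.1 * 2⁻¹ ^ j a = b a.1 * 2⁻¹ ^ j a * (2⁻¹ ^ k a * 2 ^ k a) := by rw [h3, mul_one]
      _ = _ := by ring
  · have : n ≤ (n + 2) ^ 2 := by nlinarith
    simp only [j, e, Fin.val_last]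
    omega
  · rw [← ENNReal.ofReal_natCast, ← ENNReal.ofReal_mul (hN0 a).le, half_pow]
    refine ENNReal.ofReal_le_ofReal ?_
    -- Since x ≥ b ≥ 1 / (n + 1), rounding up costs at most a factor n + 2, which u^j absorbs
    -- because j is quadratic in n.
    have h1 : (N a : ℝ) ≤ x a * (a.1 + 2) := by
      refine (hNx a).trans ?_
      have h2 := (hb a.1).trans (hxb a)
      rw [div_le_iff₀ (by positivity)] at h2
      linarith
    have h5 : N a * W a ≤ u ^ j a * (a.1 + 2) := by
      have h6 : u ^ j a = W a * x a := by
        rw [← hVW]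
        exact (div_mul_cancel₀ _ (hN0 a).ne').symm
      rw [h6, mul_comm, mul_assoc]
      exact mul_le_mul_of_nonneg_left h1 (hW0 a).le
    refine h5.trans ?_
    have h7 : (a.1 : ℝ) + 2 ≤ 2 ^ (a.1 + 1) := by
      have := natCast_succ_le_two_pow (a.1 + 1)
      push_cast at this
      linarith
    have h8 : a.1 + 1 + (a.1 + (a.2 : ℕ)) ≤ j a := by
      have h9 := hi a
      have : a.1 + 1 + (a.1 + a.1) + a.1 ≤ (a.1 + 2) ^ 2 := by nlinarith
      simp only [j]
      omega
    calc u ^ j a * (a.1 + 2) ≤ 2⁻¹ ^ j a * 2 ^ (a.1 + 1) := by gcongr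
      _ ≤ 2⁻¹ ^ (a.1 + 1 + (a.1 + (a.2 : ℕ))) * 2 ^ (a.1 + 1) := by
        refine mul_le_mul_of_nonneg_right ?_ (by positivity)
        exact pow_le_pow_of_le_one (by norm_num) (by norm_num) h8
      _ = _ := by
        rw [pow_add, mul_right_comm, ← mul_pow]
        norm_num
  · refine hd.imp id fun h => ⟨2, fun a => ?_⟩
    rw [ENNReal.coe_ofNat, ← ENNReal.ofReal_ofNat 2, ← ENNReal.ofReal_mul (by norm_num)]
    refine ENNReal.ofReal_le_ofReal ?_
    -- With x ≥ 1, rounding up at most doubles x, so W ≤ 2 V.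
    have hx1 : 1 ≤ x a := by
      have h1 : (a.1 : ℝ) ≤ (p - 1) * k a := by
        have : (d * a.1 : ℝ) ≤ k a := by
          simp only [k]
          push_cast
          linarith [Nat.cast_nonneg (α := ℝ) (a.2 : ℕ)]
        calc (a.1 : ℝ) ≤ ((p - 1) * d) * a.1 := le_mul_of_one_le_left (Nat.cast_nonneg _) h.2
          _ = (p - 1) * (d * a.1) := by ring
          _ ≤ _ := mul_le_mul_of_nonneg_left this (by linarith)
      calc (1 : ℝ) = ((a.1 : ℝ) + 1) * (1 / (a.1 + 1)) := by field_simp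
        _ ≤ 2 ^ ((p - 1) * k a) * b a.1 := by
          refine mul_le_mul ((natCast_succ_le_two_pow a.1).trans ?_) (hb _) (by positivity)
            (by positivity)
          rw [← Real.rpow_natCast]
          exact Real.rpow_le_rpow_of_exponent_le (by norm_num) h1
    refine le_of_mul_le_mul_right ?_ (hN0 a)
    rw [mul_assoc, hVW, mul_left_comm]
    refine mul_le_mul_of_nonneg_left ?_ (hW0 a).le
    linarith [hNx a]

/-- For any sequence `b` with `1 / (n + 1) ≤ b n ≤ n + 1` there is a non-doubling space in which the
maximal operator is bounded for the exponents `p`, `q`, `r` exactly when `b n * (n + 1) ^ (1 / r)`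
is bounded. -/
theorem exists_space {p : ℝ} {q : ℝ≥0∞} (h : (p = 1 ∧ q = 1) ∨ (1 < p ∧ 1 ≤ q)) (b : ℕ → ℝ)
    (hb : ∀ n : ℕ, 1 / ((n : ℝ) + 1) ≤ b n) (hb' : ∀ n : ℕ, b n ≤ (n : ℝ) + 1) :
    ∃ (U : Type) (_ : MetricSpace U) (_ : MeasurableSpace U) (_ : BorelSpace U) (μ : Measure U),
      IsFiniteBoundedSpace μ ∧ ¬ IsDoubling μ ∧ ∀ r, q ≤ r →
        (bestConst μ p q r < ∞ ↔ ∃ C : ℝ, ∀ n : ℕ, b n * ((n : ℝ) + 1) ^ (1 / r.toReal) ≤ C) := by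
  have hp : 1 ≤ p := by
    rcases h with h | h
    · exact h.1.ge
    · exact h.1.le
  have hq : 1 ≤ q := by
    rcases h with h | h
    · exact h.2.ge
    · exact h.2
  obtain ⟨D⟩ := exists_starData hp b hb hb'
  refine ⟨Pt D.N, inferInstance, inferInstance, inferInstance, D.μ,
    D.isFiniteBoundedSpace (by linarith), D.not_isDoubling, fun r hqr => ?_⟩
  have hb0 : ∀ n, 0 < b n := fun n => lt_of_lt_of_le (by positivity) (hb n)
  have hconv : ∀ n : ℕ, ENNReal.ofReal (b n) * ((n : ℝ≥0∞) + 1) ^ (1 / r.toReal) =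
      ENNReal.ofReal (b n * ((n : ℝ) + 1) ^ (1 / r.toReal)) := fun n => by
    rw [ENNReal.ofReal_mul (hb0 n).le, ← ENNReal.ofReal_rpow_of_pos (by positivity),
      ENNReal.ofReal_add (by positivity) zero_le_one, ENNReal.ofReal_natCast, ENNReal.ofReal_one]
  rw [D.bestConst_lt_top_iff]
  constructor
  · intro hB
    obtain ⟨C, hC⟩ := D.exists_le_of_bdd_maximal hp hq (hq.trans hqr) hB
    refine ⟨C, fun n => ?_⟩
    have := hC n
    simp only [hconv] at this
    rwa [← ENNReal.ofReal_coe_nnreal, ENNReal.ofReal_le_ofReal_iff C.coe_nonneg] at this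
  · rintro ⟨C, hC⟩
    refine D.bdd_maximal hp h hqr (C₀ := C.toNNReal) fun n => ?_
    simp only [hconv]
    exact ENNReal.ofReal_le_ofReal (hC n)

/-! ### Choice of the sequence -/

theorem one_div_toReal_lt {r s : ℝ≥0∞} (hr : 1 ≤ r) (h : r < s) :
    1 / s.toReal < 1 / r.toReal := by
  have hr0 : r ≠ 0 := (zero_lt_one.trans_le hr).ne'
  have h1 : s⁻¹ < r⁻¹ := ENNReal.inv_lt_inv.2 h
  simpa [ENNReal.toReal_inv] using
    (ENNReal.toReal_lt_toReal h1.ne_top (ENNReal.inv_ne_top.2 hr0)).2 h1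

theorem one_div_toReal_le {r s : ℝ≥0∞} (hr : 1 ≤ r) (h : r ≤ s) :
    1 / s.toReal ≤ 1 / r.toReal := by
  rcases h.eq_or_lt with h | h
  · rw [h]
  · exact (one_div_toReal_lt hr h).le

theorem one_div_natCast_succ_le_rpow {s : ℝ} (hs : s ≤ 1) (n : ℕ) :
    1 / ((n : ℝ) + 1) ≤ ((n : ℝ) + 1) ^ (-s) := by
  rw [one_div, ← Real.rpow_neg_one]
  exact Real.rpow_le_rpow_of_exponent_le (by linarith [Nat.cast_nonneg (α := ℝ) n]) (by linarith)

theorem bounded_rpow_iff (s t : ℝ) :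
    (∃ C : ℝ, ∀ n : ℕ, ((n : ℝ) + 1) ^ (-s) * ((n : ℝ) + 1) ^ t ≤ C) ↔ t ≤ s := by
  have h1 : ∀ n : ℕ, ((n : ℝ) + 1) ^ (-s) * ((n : ℝ) + 1) ^ t = ((n : ℝ) + 1) ^ (t - s) :=
    fun n => by
      rw [← Real.rpow_add (by positivity)]
      congr 1
      ring
  simp only [h1]
  constructor
  · rintro ⟨C, hC⟩
    by_contra hlt
    have ht := ((tendsto_rpow_atTop (show 0 < t - s by linarith)).comp
      (Filter.tendsto_atTop_add_const_right _ (1 : ℝ) tendsto_natCast_atTop_atTop)).eventually_gt_atTop C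
    obtain ⟨n, hn⟩ := ht.exists
    exact absurd (hC n) (not_le.2 hn)
  · intro h
    exact ⟨1, fun n => Real.rpow_le_one_of_one_le_of_nonpos
      (by linarith [Nat.cast_nonneg (α := ℝ) n]) (by linarith)⟩

/-- The logarithm is unbounded but loses to every positive power, so it only excludes the endpoint t
= s. -/
theorem bounded_log_mul_rpow_iff (s t : ℝ) :
    (∃ C : ℝ, ∀ n : ℕ, (1 + Real.log ((n : ℝ) + 1)) * ((n : ℝ) + 1) ^ (-s) *
      ((n : ℝ) + 1) ^ t ≤ C) ↔ t < s := by
  have h1 : ∀ n : ℕ, (1 + Real.log ((n : ℝ) + 1)) * ((n : ℝ) + 1) ^ (-s) * ((n : ℝ) + 1) ^ t =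
      (1 + Real.log ((n : ℝ) + 1)) * ((n : ℝ) + 1) ^ (t - s) :=
    fun n => by
      rw [mul_assoc, ← Real.rpow_add (by positivity)]
      congr 2
      ring
  have hn1 : ∀ n : ℕ, (1 : ℝ) ≤ (n : ℝ) + 1 := fun n => by
    linarith [Nat.cast_nonneg (α := ℝ) n]
  simp only [h1]
  constructor
  · rintro ⟨C, hC⟩
    by_contra hlt
    have ht := (Real.tendsto_log_atTop.comp
      (Filter.tendsto_atTop_add_const_right _ (1 : ℝ) tendsto_natCast_atTop_atTop)).eventually_gt_atTop C
    obtain ⟨n, hn⟩ := ht.exists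
    refine absurd (hC n) (not_le.2 (hn.trans_le ?_))
    have h2 : 0 ≤ Real.log ((n : ℝ) + 1) := Real.log_nonneg (hn1 n)
    have h3 : (1 : ℝ) ≤ ((n : ℝ) + 1) ^ (t - s) := Real.one_le_rpow (hn1 n) (by linarith)
    simp only [Function.comp_apply]
    nlinarith
  · intro h
    have hδ : 0 < s - t := by linarith
    refine ⟨1 + 1 / (s - t), fun n => ?_⟩
    have h2 := Real.log_le_rpow_div (zero_le_one.trans (hn1 n)) hδ
    have h3 : ((n : ℝ) + 1) ^ (t - s) ≤ 1 :=
      Real.rpow_le_one_of_one_le_of_nonpos (hn1 n) (by linarith)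
    have h4 : ((n : ℝ) + 1) ^ (s - t) * ((n : ℝ) + 1) ^ (t - s) = 1 := by
      rw [← Real.rpow_add (by positivity)]
      simp
    have h5 : (0 : ℝ) ≤ ((n : ℝ) + 1) ^ (t - s) := by positivity
    calc (1 + Real.log ((n : ℝ) + 1)) * ((n : ℝ) + 1) ^ (t - s)
        ≤ (1 + ((n : ℝ) + 1) ^ (s - t) / (s - t)) * ((n : ℝ) + 1) ^ (t - s) := by gcongr
      _ = ((n : ℝ) + 1) ^ (t - s) +
          (((n : ℝ) + 1) ^ (s - t) * ((n : ℝ) + 1) ^ (t - s)) / (s - t) := by ring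
      _ ≤ _ := by rw [h4]; linarith

end LorentzMaximal

end

theorem theorem1 (p₀ : ℝ) (q₀ r₀ : ℝ≥0∞) (h : LorentzMaximal.Admissible p₀ q₀ r₀) :
    (∃ (U : Type) (_ : MetricSpace U) (_ : MeasurableSpace U) (_ : BorelSpace U) (μ : Measure U),
      LorentzMaximal.IsFiniteBoundedSpace μ ∧ ¬ LorentzMaximal.IsDoubling μ ∧
      (∀ r ∈ Set.Icc q₀ r₀, LorentzMaximal.bestConst μ p₀ q₀ r = ∞) ∧
      (∀ r ∈ Set.Ioc r₀ ∞, LorentzMaximal.bestConst μ p₀ q₀ r < ∞)) ∧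
    (∃ (V : Type) (_ : MetricSpace V) (_ : MeasurableSpace V) (_ : BorelSpace V) (μ : Measure V),
      LorentzMaximal.IsFiniteBoundedSpace μ ∧ ¬ LorentzMaximal.IsDoubling μ ∧
      (∀ r ∈ Set.Ico q₀ r₀, LorentzMaximal.bestConst μ p₀ q₀ r = ∞) ∧
      (∀ r ∈ Set.Icc r₀ ∞, LorentzMaximal.bestConst μ p₀ q₀ r < ∞)) := by
  have hpq : (p₀ = 1 ∧ q₀ = 1) ∨ (1 < p₀ ∧ 1 ≤ q₀) := by
    rcases h with h | h
    · exact Or.inl ⟨h.1, h.2.1⟩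
    · exact Or.inr ⟨h.1, h.2.1⟩
  have hq : 1 ≤ q₀ := by
    rcases h with h | h
    · exact h.2.1.ge
    · exact h.2.1
  have hqr : q₀ ≤ r₀ := by
    rcases h with h | h
    · exact h.2.1.trans_le h.2.2
    · exact h.2.2
  have hr : 1 ≤ r₀ := hq.trans hqr
  have hs1 : 1 / r₀.toReal ≤ 1 := by
    simpa using LorentzMaximal.one_div_toReal_le le_rfl hr
  have hs0 : 0 ≤ 1 / r₀.toReal := by positivity
  have hn1 : ∀ n : ℕ, (1 : ℝ) ≤ (n : ℝ) + 1 := fun n => by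
    linarith [Nat.cast_nonneg (α := ℝ) n]
  have hle1 : ∀ n : ℕ, ((n : ℝ) + 1) ^ (-(1 / r₀.toReal)) ≤ 1 := fun n =>
    Real.rpow_le_one_of_one_le_of_nonpos (hn1 n) (by linarith)
  constructor
  · obtain ⟨U, i₁, i₂, i₃, μ, hμ, hμ', hc⟩ := LorentzMaximal.exists_space hpq
      -- The logarithm makes r = r₀ fail; adding 1 keeps the lower bound 1 / (n + 1), also at n = 0.
      (fun n : ℕ => (1 + Real.log ((n : ℝ) + 1)) * ((n : ℝ) + 1) ^ (-(1 / r₀.toReal)))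
      (fun n => (LorentzMaximal.one_div_natCast_succ_le_rpow hs1 n).trans
        (le_mul_of_one_le_left (by positivity) (by linarith [Real.log_nonneg (hn1 n)])))
      (fun n => by
        have h1 := Real.log_le_sub_one_of_pos (show (0 : ℝ) < (n : ℝ) + 1 by positivity)
        refine (mul_le_of_le_one_right (by linarith [Real.log_nonneg (hn1 n)]) (hle1 n)).trans ?_
        linarith)
    refine ⟨U, i₁, i₂, i₃, μ, hμ, hμ', fun r hr' => ?_, fun r hr' => ?_⟩
    · rw [← not_lt_top_iff, hc r hr'.1, LorentzMaximal.bounded_log_mul_rpow_iff, not_lt]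
      exact LorentzMaximal.one_div_toReal_le (hq.trans hr'.1) hr'.2
    · rw [hc r (hqr.trans hr'.1.le), LorentzMaximal.bounded_log_mul_rpow_iff]
      exact LorentzMaximal.one_div_toReal_lt hr hr'.1
  · obtain ⟨V, i₁, i₂, i₃, μ, hμ, hμ', hc⟩ := LorentzMaximal.exists_space hpq
      (fun n : ℕ => ((n : ℝ) + 1) ^ (-(1 / r₀.toReal)))
      (LorentzMaximal.one_div_natCast_succ_le_rpow hs1) (fun n => (hle1 n).trans (hn1 n))
    refine ⟨V, i₁, i₂, i₃, μ, hμ, hμ', fun r hr' => ?_, fun r hr' => ?_⟩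
    · rw [← not_lt_top_iff, hc r hr'.1, LorentzMaximal.bounded_rpow_iff, not_le]
      exact LorentzMaximal.one_div_toReal_lt (hq.trans hr'.1) hr'.2
    · rw [hc r (hqr.trans hr'.1), LorentzMaximal.bounded_rpow_iff]
      exact LorentzMaximal.one_div_toReal_le hr hr'.1
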